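/- Let $\mathcal G$ be a locally compact Hausdorff étale groupoid (a topological groupoid, with continuous structure maps, whose underlying space is locally compact Hausdorff and whose range map $r:\mathcal G\to\mathcal G^{(0)}$ is a local homeomorphism), with source map $s$ and source fibres $\mathcal G_x=s^{-1}(x)$. Let $C_c(\mathcal G)$ be the $*$-algebra of continuous compactly supported functions $\mathcal G\to\mathbb C$ with $$(f*g)(\gamma)=\sum_{\alpha\in\mathcal G_{s(\gamma)}}f(\gamma\alpha^{-1})g(\alpha),\qquad f^*(\gamma)=\overline{f(\gamma^{-1})}.$$ For $x\in\mathcal G^{(0)}$ let $\lambda_x:C_c(\mathcal G)\to\mathscr B(\ell^2(\mathcal G_x))$, $(\lambda_x(f)\xi)(\gamma)=\sum_{\alpha\in\mathcal G_x}f(\gamma\alpha^{-1})\xi(\alpha)$, and let $C^*_r(\mathcal G)$ be the completion of $C_c(\mathcal G)$ in the norm $\|f\|_r=\sup_{x\in\mathcal G^{(0)}}\|\lambda_x(f)\|$. Let $L^2(\mathcal G)$ be the Hilbert $C_0(\mathcal G^{(0)})$-module obtained by completing $C_c(\mathcal G)$ with respect to the inner product $\langle\eta,\xi\rangle(x)=\sum_{\gamma\in\mathcal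 G_x}\overline{\eta(\gamma)}\xi(\gamma)$, with the module structure $(\xi a)(\gamma)=\xi(\gamma)a(s(\gamma))$; its elements are regarded as functions on $\mathcal G$. Let $\mathscr L(L^2(\mathcal G))$ be the $C^*$-algebra of adjointable operators on $L^2(\mathcal G)$, and let $\Lambda:C_c(\mathcal G)\to\mathscr L(L^2(\mathcal G))$ be the left regular representation, $(\Lambda(f)\xi)(\gamma)=\sum_{\alpha\in\mathcal G_{s(\gamma)}}f(\gamma\alpha^{-1})\xi(\alpha)$. For $g\in C_c(\mathcal G)$ let $\rho(g)$ be the bounded linear operator on $L^2(\mathcal G)$ with $\rho(g)\xi=\xi*g$ for $\xi\in C_c(\mathcal G)$. An operator $T\in\mathscr L(L^2(\mathcal G))$ is called - *$\mathcal G$-equivariant* if $T\rho(g)=\rho(g)T$ for all $g\in C_c(\mathcal G)$; - *compactly supported* if there is a compact set $K\subseteq\mathcal G$ such that $gTf=0$ for all $f,g\in C_b(\mathcal G)$ with $(K\cdot\mathrm{supp}(f))\cap\mathrm{supp}(g)=\emptyset$ and $\mathrm{supp}(f)\cap(K\cdot\mathrm{supp}(g))=\emptyset$. Here $f,g\in C_b(\mathcal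 G)$ (bounded continuous functions) act on $L^2(\mathcal G)$ by pointwise multiplication, and $A\cdot B=\{\alpha\beta:\alpha\in A,\ \beta\in B,\ s(\alpha)=r(\beta)\}$. Let $\mathbb C_u[\mathcal G]^{\mathcal G}\subseteq\mathscr L(L^2(\mathcal G))$ be the set of compactly supported $\mathcal G$-equivariant operators. Then: 1. $\mathbb C_u[\mathcal G]^{\mathcal G}$ is a $*$-subalgebra of $\mathscr L(L^2(\mathcal G))$, one has $\mathbb C_u[\mathcal G]^{\mathcal G}=\Lambda(C_c(\mathcal G))$, and $\Lambda:C_c(\mathcal G)\to\mathbb C_u[\mathcal G]^{\mathcal G}$ is a $*$-isomorphism. 2. Consequently, the norm closure of $\mathbb C_u[\mathcal G]^{\mathcal G}$ in $\mathscr L(L^2(\mathcal G))$ is $C^*$-isomorphic to $C^*_r(\mathcal G)$, by an isometric $*$-isomorphism that sends $\Lambda(f)$ to $f$ for every $f\in C_c(\mathcal G)$. -/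

import Mathlib

open Topology Filter
open scoped ENNReal ZeroAtInfty CompactlySupported BoundedContinuousFunction ComplexOrder ComplexConjugate

noncomputable section

/-- A groupoid, presented by its set `G` of arrows: unit space `units ⊆ G`, source and range maps
`src, rng : G → units`, a composition law and an inverse map. The composite `a * b` is meaningful
only when `src a = rng b`; the values of `*` on other pairs are irrelevant and never used. -/
class ArrowGroupoid (G : Type*) extends Mul G, Inv G where
  /-- The unit space. -/
  units : Set G
  /-- The source map. -/
  src : G → units
  /-- The range map. -/
  rng : G → units
  src_unit : ∀ x : units, src (x : G) = x
  rng_unit : ∀ x : units, rng (x : G) = x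
  src_mul : ∀ a b : G, src a = rng b → src (a * b) = src b
  rng_mul : ∀ a b : G, src a = rng b → rng (a * b) = rng a
  assoc : ∀ a b c : G, src a = rng b → src b = rng c → a * b * c = a * (b * c)
  mul_src : ∀ a : G, a * (src a : G) = a
  rng_mul_self : ∀ a : G, (rng a : G) * a = a
  src_inv : ∀ a : G, src a⁻¹ = rng a
  rng_inv : ∀ a : G, rng a⁻¹ = src a
  inv_mul_eq : ∀ a : G, a⁻¹ * a = (src a : G)
  mul_inv_eq : ∀ a : G, a * a⁻¹ = (rng a : G)

/-- An étale topological groupoid: the structure maps are continuous (composition on the set of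
composable pairs, `units` with the subspace topology), and the range map is a local
homeomorphism onto the unit space. -/
class EtaleGroupoid (G : Type*) [TopologicalSpace G] extends ArrowGroupoid G where
  continuous_src : Continuous src
  continuous_rng : Continuous rng
  continuous_inv : Continuous fun a : G => a⁻¹
  continuousOn_mul : ContinuousOn (fun p : G × G => p.1 * p.2) {p | src p.1 = rng p.2}
  isLocalHomeomorph_rng : IsLocalHomeomorph rng

namespace EtaleGroupoid

open ArrowGroupoid

section Algebra

/-- The unit space `G⁰`, with the subspace topology when `G` carries one. -/
abbrev UnitSpace (G : Type*) [ArrowGroupoid G] : Type _ := (units : Set G)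

variable {G : Type*} [ArrowGroupoid G]

/-- The source fibre `G_x`. -/
abbrev Fib (x : UnitSpace G) : Type _ := {γ : G // src γ = x}

/-- The unit `x`, as an element of `G_x`. -/
def Fib.unit (x : UnitSpace G) : Fib x := ⟨x, src_unit x⟩

lemma src_div {a b : G} (h : src a = src b) : src (a * b⁻¹) = rng b := by
  rw [src_mul _ _ (by rw [rng_inv, h]), src_inv]

lemma rng_div {a b : G} (h : src a = src b) : rng (a * b⁻¹) = rng a :=
  rng_mul _ _ (by rw [rng_inv, h])

lemma inv_inv' (a : G) : a⁻¹⁻¹ = a := by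
  have h1 : (a⁻¹⁻¹ * a⁻¹) * a = a⁻¹⁻¹ * (a⁻¹ * a) :=
    assoc _ _ _ (by rw [src_inv]) (by rw [src_inv])
  rw [inv_mul_eq, inv_mul_eq, src_inv, rng_mul_self] at h1
  have h2 := mul_src (a⁻¹⁻¹)
  rw [src_inv, rng_inv] at h2
  rw [h2] at h1
  exact h1.symm

lemma div_mul_self {a b : G} (h : src a = src b) : a * b⁻¹ * b = a := by
  rw [assoc _ _ _ (by rw [rng_inv, h]) (by rw [src_inv]), inv_mul_eq, ← h, mul_src]

lemma mul_div_self {a b : G} (h : src a = rng b) : a * b * b⁻¹ = a := by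
  rw [assoc _ _ _ h (by rw [rng_inv]), mul_inv_eq, ← h, mul_src]

/-- `(ab)⁻¹ = b⁻¹ a⁻¹`. -/
lemma mul_inv_rev' {a b : G} (h : src a = rng b) : (a * b)⁻¹ = b⁻¹ * a⁻¹ := by
  have h0 : src (a * b) = src b := src_mul _ _ h
  have h1 : src b⁻¹ = rng a⁻¹ := by rw [src_inv, rng_inv, h]
  have h2 : src (b⁻¹ * a⁻¹) = rng (a * b) := by rw [src_mul _ _ h1, src_inv, rng_mul _ _ h]
  have h3 : b⁻¹ * a⁻¹ * (a * b) = (src b : G) := by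
    rw [assoc _ _ _ h1 (by rw [src_inv, rng_mul _ _ h]), ← assoc a⁻¹ a b (by rw [src_inv]) h,
      inv_mul_eq, h, rng_mul_self, inv_mul_eq]
  have h4 := mul_div_self h2
  rw [h3, ← h0, ← rng_inv (a * b), rng_mul_self] at h4
  exact h4

/-- `(ac)(bc)⁻¹ = a b⁻¹`. -/
lemma mul_div_mul {a b c : G} (ha : src a = rng c) (hb : src b = rng c) :
    a * c * (b * c)⁻¹ = a * b⁻¹ := by
  rw [mul_inv_rev' hb, ← assoc _ _ _ (by rw [src_mul _ _ ha, rng_inv])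
    (by rw [src_inv, rng_inv, hb]), mul_div_self ha]

lemma inv_div {a b : G} (h : src a = src b) : (a * b⁻¹)⁻¹ = b * a⁻¹ := by
  rw [mul_inv_rev' (by rw [rng_inv, h]), inv_inv']

/-- `(a c⁻¹)(b c⁻¹)⁻¹ = a b⁻¹`. -/
lemma div_div_div {a b c : G} (ha : src a = src c) (hb : src b = src c) :
    a * c⁻¹ * (b * c⁻¹)⁻¹ = a * b⁻¹ :=
  mul_div_mul (by rw [rng_inv, ha]) (by rw [rng_inv, hb])

/-- Right translation `γ ↦ γ β⁻¹`, a bijection from `G_x` onto `G_{r(β)}` for `β ∈ G_x`. -/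
def rdiv {x : UnitSpace G} (β : Fib x) : Fib x ≃ Fib (rng β.1) where
  toFun γ := ⟨γ.1 * β.1⁻¹, src_div (γ.2.trans β.2.symm)⟩
  invFun γ := ⟨γ.1 * β.1, (src_mul _ _ γ.2).trans β.2⟩
  left_inv γ := Subtype.ext (div_mul_self (γ.2.trans β.2.symm))
  right_inv γ := Subtype.ext (mul_div_self γ.2)

end Algebra

section Topology

variable {G : Type*} [TopologicalSpace G] [EtaleGroupoid G]

lemma isLocalHomeomorph_src : IsLocalHomeomorph (src : G → UnitSpace G) := by
  have h : (src : G → UnitSpace G) = rng ∘ (Homeomorph.mk ⟨fun a : G => a⁻¹, fun a => a⁻¹,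
      fun a => inv_inv' a, fun a => inv_inv' a⟩ continuous_inv continuous_inv) := by
    funext a; exact (rng_inv a).symm
  rw [h]
  exact isLocalHomeomorph_rng.comp (Homeomorph.isLocalHomeomorph _)

/-- A compact set meets the source fibres in uniformly finitely many points. -/
lemma exists_card_le {K : Set G} (hK : IsCompact K) :
    ∃ N : ℕ, ∀ (x : UnitSpace G) (s : Finset (Fib x)), (∀ γ ∈ s, γ.1 ∈ K) → s.card ≤ N := by
  have h : ∀ a : G, ∃ U ∈ 𝓝 a, Set.InjOn (src : G → UnitSpace G) U := by
    intro a
    obtain ⟨e, ha, he⟩ := isLocalHomeomorph_src a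
    exact ⟨e.source, e.open_source.mem_nhds ha, he ▸ e.injOn⟩
  choose U hU hinj using h
  obtain ⟨t, -, ht⟩ := hK.elim_nhds_subcover U fun a _ => hU a
  refine ⟨t.card, fun x s hs => ?_⟩
  have h2 : ∀ γ : Fib x, ∃ a, γ ∈ s → a ∈ t ∧ γ.1 ∈ U a := by
    intro γ
    by_cases hγ : γ ∈ s
    · have := ht (hs γ hγ)
      simp only [Set.mem_iUnion] at this
      obtain ⟨a, ha, h⟩ := this
      exact ⟨a, fun _ => ⟨ha, h⟩⟩
    · exact ⟨γ.1, fun h => absurd h hγ⟩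
  choose φ hφ using h2
  refine Finset.card_le_card_of_injOn φ (fun γ hγ => (hφ γ hγ).1) ?_
  intro γ hγ δ hδ hγδ
  have h3 := (hφ δ hδ).2
  rw [← hγδ] at h3
  exact Subtype.ext (hinj _ (hφ γ hγ).2 h3 (γ.2.trans δ.2.symm))

lemma finite_fib {K : Set G} (hK : IsCompact K) (x : UnitSpace G) : {γ : Fib x | γ.1 ∈ K}.Finite := by
  obtain ⟨N, hN⟩ := exists_card_le hK
  by_contra hinf
  obtain ⟨s, hs, hc⟩ := Set.Infinite.exists_subset_card_eq hinf (N + 1)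
  have := hN x s fun γ hγ => hs hγ
  omega

/-- Over a neighbourhood of `x₀`, a compact set is covered by finitely many disjoint local
sections of the source map. -/
lemma exists_sections [T2Space G] {K : Set G} (hK : IsCompact K) (x₀ : UnitSpace G) :
    ∃ (t : Finset (Fib x₀)) (σ : Fib x₀ → UnitSpace G → G),
      (∀ a ∈ t, σ a x₀ = a.1 ∧ ContinuousAt (σ a) x₀) ∧
      ∀ᶠ x in 𝓝 x₀, (∀ a ∈ t, src (σ a x) = x) ∧ Set.InjOn (fun a => σ a x) t ∧
        ∀ γ ∈ K, src γ = x → ∃ a ∈ t, γ = σ a x := by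
  classical
  set t : Finset (Fib x₀) := (finite_fib hK x₀).toFinset with ht
  have hmem : ∀ a : Fib x₀, a ∈ t ↔ a.1 ∈ K := fun a => by simp [ht]
  have h : ∀ a : Fib x₀, ∃ e : OpenPartialHomeomorph G (UnitSpace G), a.1 ∈ e.source ∧ src = e :=
    fun a => isLocalHomeomorph_src a.1
  choose e hae he using h
  obtain ⟨D, hD, hdisj⟩ := (t.finite_toSet.image (Subtype.val : Fib x₀ → G)).t2_separation
  set W : Fib x₀ → Set G := fun a => (e a).source ∩ D a.1 with hW
  have hWo : ∀ a, IsOpen (W a) := fun a => (e a).open_source.inter (hD _).2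
  have haW : ∀ a : Fib x₀, a.1 ∈ W a := fun a => ⟨hae a, (hD _).1⟩
  have hsymm : ∀ a : Fib x₀, (e a).symm x₀ = a.1 := by
    intro a
    have h1 : e a a.1 = x₀ := by rw [← he a, a.2]
    exact (congrArg (e a).symm h1).symm.trans ((e a).left_inv (hae a))
  have hcont : ∀ a : Fib x₀, ContinuousAt (e a).symm x₀ := by
    intro a
    have h1 : e a a.1 = x₀ := by rw [← he a, a.2]
    have h2 : x₀ ∈ (e a).target := h1 ▸ (e a).map_source (hae a)
    exact (e a).continuousAt_symm h2
  refine ⟨t, fun a => (e a).symm, fun a _ => ⟨hsymm a, hcont a⟩, ?_⟩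
  have hev1 : ∀ᶠ x in 𝓝 x₀, ∀ a ∈ t, x ∈ (e a).target ∧ (e a).symm x ∈ W a := by
    rw [Filter.eventually_all_finset]
    intro a _
    have h1 : e a a.1 = x₀ := by rw [← he a, a.2]
    have h2 : x₀ ∈ (e a).target := h1 ▸ (e a).map_source (hae a)
    have h3 : W a ∈ 𝓝 ((e a).symm x₀) := by rw [hsymm]; exact (hWo a).mem_nhds (haW a)
    filter_upwards [(e a).open_target.mem_nhds h2, hcont a h3] with x hx1 hx2
    exact ⟨hx1, hx2⟩
  have hK' : IsCompact (K \ ⋃ a ∈ t, W a) := hK.diff (isOpen_biUnion fun a _ => hWo a)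
  have hev2 : ∀ᶠ x in 𝓝 x₀, x ∉ src '' (K \ ⋃ a ∈ t, W a) := by
    refine (hK'.image continuous_src).isClosed.isOpen_compl.mem_nhds ?_
    rintro ⟨γ, ⟨hγK, hγ⟩, hx⟩
    refine hγ ?_
    exact Set.mem_iUnion₂.2 ⟨⟨γ, hx⟩, (hmem _).2 hγK, haW _⟩
  filter_upwards [hev1, hev2] with x h1 h2
  refine ⟨fun a ha => ?_, fun a ha b hb hab => ?_, fun γ hγ hx => ?_⟩
  · rw [he a, (e a).right_inv (h1 a ha).1]
  · by_contra hne
    have hd := hdisj (Set.mem_image_of_mem _ ha) (Set.mem_image_of_mem _ hb)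
      (fun h => hne (Subtype.ext h))
    have h3 : (e a).symm x = (e b).symm x := hab
    exact Set.disjoint_left.1 hd (h1 a ha).2.2 (h3 ▸ (h1 b hb).2.2)
  · by_cases hγ' : γ ∈ ⋃ a ∈ t, W a
    · obtain ⟨a, ha, hγa⟩ := Set.mem_iUnion₂.1 hγ'
      refine ⟨a, ha, ?_⟩
      rw [← hx, he a, (e a).left_inv hγa.1]
    · exact absurd ⟨γ, ⟨hγ, hγ'⟩, hx⟩ h2

/-- Continuity of sums over source fibres. -/
lemma continuousAt_tsum [T2Space G] {Y : Type*} [TopologicalSpace Y] {p : Y → UnitSpace G} {y₀ : Y}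
    (hp : ContinuousAt p y₀) {K : Set G} (hK : IsCompact K) (F : Y → G → ℂ)
    (hF0 : ∀ y α, src α = p y → α ∉ K → F y α = 0)
    (hF : ∀ α, src α = p y₀ → Tendsto (fun q : Y × G => F q.1 q.2)
      (𝓝[{q : Y × G | src q.2 = p q.1}] (y₀, α)) (𝓝 (F y₀ α))) :
    ContinuousAt (fun y => ∑' α : Fib (p y), F y α.1) y₀ := by
  classical
  obtain ⟨t, σ, hσ, hev⟩ := exists_sections hK (p y₀)
  have hev' := hp.eventually hev
  have heq : ∀ᶠ y in 𝓝 y₀, ∑' α : Fib (p y), F y α.1 = ∑ a ∈ t, F y (σ a (p y)) := by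
    filter_upwards [hev'] with y hy
    obtain ⟨h1, h2, h3⟩ := hy
    set T : Finset (Fib (p y)) := t.attach.image fun a => ⟨σ a.1 (p y), h1 a.1 a.2⟩ with hT
    rw [tsum_eq_sum (s := T), hT, Finset.sum_image, ← Finset.sum_attach t]
    · intro a _ b _ hab
      exact Subtype.ext (h2 a.2 b.2 (congrArg Subtype.val hab))
    · intro α hα
      refine hF0 y α.1 α.2 fun hαK => hα ?_
      obtain ⟨a, ha, h⟩ := h3 α.1 hαK α.2
      exact Finset.mem_image.2 ⟨⟨a, ha⟩, Finset.mem_attach _ _, Subtype.ext h.symm⟩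
  refine (ContinuousAt.congr ?_ (heq.mono fun _ h => h.symm))
  refine tendsto_finsetSum _ fun a ha => ?_
  have h0 : σ a (p y₀) = a.1 := (hσ a ha).1
  have hlim : Tendsto (fun y => (y, σ a (p y))) (𝓝 y₀)
      (𝓝[{q : Y × G | src q.2 = p q.1}] (y₀, a.1)) := by
    refine tendsto_nhdsWithin_iff.2 ⟨?_, ?_⟩
    · have := (hσ a ha).2.tendsto.comp hp.tendsto
      rw [h0] at this
      exact Tendsto.prodMk_nhds tendsto_id this
    · filter_upwards [hev'] with y hy
      exact hy.1 a ha
  have := (hF a.1 a.2).comp hlim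
  rwa [← h0] at this

end Topology

section ConvolutionAlgebra

/-- The space `C_c(G)`. It is a type synonym of `C_c(G, ℂ)`, because it carries the convolution
product and involution instead of the pointwise ones. -/
def Cc (G : Type*) [TopologicalSpace G] : Type _ := C_c(G, ℂ)

variable {G : Type*} [TopologicalSpace G]

namespace Cc

instance : AddCommGroup (Cc G) := inferInstanceAs (AddCommGroup C_c(G, ℂ))
instance : Module ℂ (Cc G) := inferInstanceAs (Module ℂ C_c(G, ℂ))
instance : FunLike (Cc G) G ℂ := inferInstanceAs (FunLike C_c(G, ℂ) G ℂ)

/-- A continuous function with compact support, as an element of `C_c(G)`. -/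
def mk (f : G → ℂ) (hf : Continuous f) (hs : HasCompactSupport f) : Cc G :=
  (⟨⟨f, hf⟩, hs⟩ : C_c(G, ℂ))

@[simp] lemma mk_apply (f : G → ℂ) (hf : Continuous f) (hs : HasCompactSupport f) (γ : G) :
    mk f hf hs γ = f γ := rfl

@[ext] lemma ext {f g : Cc G} (h : ∀ γ, f γ = g γ) : f = g := DFunLike.ext f g h

lemma continuous (f : Cc G) : Continuous f := f.toContinuousMap.continuous

lemma isCompact (f : Cc G) : IsCompact (tsupport f) := f.hasCompactSupport'

@[simp] lemma add_apply (f g : Cc G) (γ : G) : (f + g) γ = f γ + g γ := rfl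
@[simp] lemma smul_apply (c : ℂ) (f : Cc G) (γ : G) : (c • f) γ = c * f γ := rfl
@[simp] lemma zero_apply (γ : G) : (0 : Cc G) γ = 0 := rfl
@[simp] lemma neg_apply (f : Cc G) (γ : G) : (-f) γ = -f γ := rfl

lemma mem_of_ne {f : Cc G} {γ : G} (h : f γ ≠ 0) : γ ∈ tsupport f := subset_tsupport _ h

lemma eq_zero_of_notMem {f : Cc G} {γ : G} (h : γ ∉ tsupport f) : f γ = 0 :=
  image_eq_zero_of_notMem_tsupport h

lemma exists_norm_le (f : Cc G) : ∃ M : ℝ, 0 ≤ M ∧ ∀ γ, ‖f γ‖ ≤ M := by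
  obtain ⟨M, hM⟩ := f.continuous.bounded_above_of_compact_support f.hasCompactSupport'
  exact ⟨max M 0, le_max_right _ _, fun γ => (hM γ).trans (le_max_left _ _)⟩

variable [EtaleGroupoid G]

/-- The involution `f*(γ) = conj (f(γ⁻¹))`. -/
instance : Star (Cc G) where
  star f := mk (fun γ => conj (f γ⁻¹))
    (Complex.continuous_conj.comp (f.continuous.comp continuous_inv)) (by
      have hemb : HasCompactSupport fun γ : G => f γ⁻¹ :=
        HasCompactSupport.comp_homeomorph f.hasCompactSupport'
          (Homeomorph.mk ⟨fun a : G => a⁻¹, fun a => a⁻¹, fun a => inv_inv' a,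
            fun a => inv_inv' a⟩ continuous_inv continuous_inv)
      exact hemb.comp_left (map_zero _))

lemma star_apply (f : Cc G) (γ : G) : star f γ = conj (f γ⁻¹) := rfl

lemma star_div (f : Cc G) {a b : G} (h : src a = src b) :
    star f (a * b⁻¹) = conj (f (b * a⁻¹)) := by rw [star_apply, inv_div h]

/-- For fixed `α ∈ G_x`, the function `γ ↦ f(γα⁻¹)` on `G_x` has few non-zero values. -/
lemma exists_card_le' (f : Cc G) : ∃ N : ℕ, ∀ (x : UnitSpace G) (α : Fib x) (s : Finset (Fib x)),
    (∀ γ ∈ s, f (γ.1 * α.1⁻¹) ≠ 0) → s.card ≤ N := by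
  obtain ⟨N, hN⟩ := exists_card_le f.isCompact
  refine ⟨N, fun x α s hs => ?_⟩
  rw [← Finset.card_map (rdiv α).toEmbedding]
  refine hN _ _ fun δ hδ => ?_
  obtain ⟨γ, hγ, rfl⟩ := Finset.mem_map.1 hδ
  exact mem_of_ne (hs γ hγ)

/-- For fixed `γ ∈ G_x`, the function `α ↦ f(γα⁻¹)` on `G_x` has few non-zero values. -/
lemma exists_card_le'' (f : Cc G) : ∃ N : ℕ, ∀ (x : UnitSpace G) (γ : Fib x) (s : Finset (Fib x)),
    (∀ α ∈ s, f (γ.1 * α.1⁻¹) ≠ 0) → s.card ≤ N := by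
  obtain ⟨N, hN⟩ := exists_card_le' (star f)
  refine ⟨N, fun x γ s hs => hN x γ s fun α hα => ?_⟩
  rw [star_div f (α.2.trans γ.2.symm)]
  exact (map_ne_zero _).2 (hs α hα)

lemma finite_div (f : Cc G) {x : UnitSpace G} (γ : Fib x) :
    {α : Fib x | f (γ.1 * α.1⁻¹) ≠ 0}.Finite := by
  obtain ⟨N, hN⟩ := exists_card_le'' f
  by_contra hinf
  obtain ⟨s, hs, hc⟩ := Set.Infinite.exists_subset_card_eq hinf (N + 1)
  have := hN x γ s fun γ hγ => hs hγ
  omega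

variable [T2Space G]

/-- The convolution product `(f * g)(γ) = ∑_{α ∈ G_{s(γ)}} f(γα⁻¹) g(α)`. -/
instance : Mul (Cc G) where
  mul f g := mk (fun γ => ∑' α : Fib (src γ), f (γ * α.1⁻¹) * g α.1)
    (by
      rw [continuous_iff_continuousAt]
      intro γ₀
      refine continuousAt_tsum (p := src) continuous_src.continuousAt g.isCompact
        (fun γ α => f (γ * α⁻¹) * g α) (fun γ α _ h => by rw [eq_zero_of_notMem h, mul_zero]) ?_
      intro α hα
      have h1 : Tendsto (fun q : G × G => (q.1, q.2⁻¹)) (𝓝[{q | src q.2 = src q.1}] (γ₀, α))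
          (𝓝[{p : G × G | src p.1 = rng p.2}] (γ₀, α⁻¹)) := by
        refine tendsto_nhdsWithin_iff.2 ⟨?_, ?_⟩
        · have : Continuous fun q : G × G => (q.1, q.2⁻¹) :=
            continuous_fst.prodMk (continuous_inv.comp continuous_snd)
          exact (this.tendsto (γ₀, α)).mono_left nhdsWithin_le_nhds
        · filter_upwards [self_mem_nhdsWithin] with q hq
          rw [rng_inv]; exact hq.symm
      have h2 : Tendsto (fun p : G × G => p.1 * p.2) (𝓝[{p : G × G | src p.1 = rng p.2}] (γ₀, α⁻¹))
          (𝓝 (γ₀ * α⁻¹)) :=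
        continuousOn_mul (γ₀, α⁻¹) (by change src γ₀ = rng α⁻¹; rw [rng_inv, hα])
      refine Tendsto.mul ((f.continuous.tendsto _).comp (h2.comp h1)) ?_
      exact ((g.continuous.comp continuous_snd).tendsto (γ₀, α)).mono_left nhdsWithin_le_nhds)
    (by
      have hS : IsClosed {p : G × G | src p.1 = rng p.2} :=
        isClosed_eq (continuous_src.comp continuous_fst) (continuous_rng.comp continuous_snd)
      have hK : IsCompact ((tsupport f ×ˢ tsupport g) ∩ {p : G × G | src p.1 = rng p.2}) :=
        (f.isCompact.prod g.isCompact).inter_right hS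
      have hK' := hK.image_of_continuousOn (continuousOn_mul.mono Set.inter_subset_right)
      refine HasCompactSupport.intro hK' fun γ hγ => ?_
      have : ∀ α : Fib (src γ), f (γ * α.1⁻¹) * g α.1 = 0 := by
        intro α
        by_contra hne
        refine hγ ⟨(γ * α.1⁻¹, α.1), ⟨⟨mem_of_ne (left_ne_zero_of_mul hne),
          mem_of_ne (right_ne_zero_of_mul hne)⟩, ?_⟩, ?_⟩
        · exact src_div α.2.symm
        · exact div_mul_self α.2.symm
      simp [this])

lemma mul_apply (f g : Cc G) (γ : G) :
    (f * g) γ = ∑' α : Fib (src γ), f (γ * α.1⁻¹) * g α.1 := rfl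

/-- `(f * g)(γα⁻¹) = ∑_{δ ∈ G_x} f(γδ⁻¹) g(δα⁻¹)` for `γ, α ∈ G_x`. -/
lemma mul_div (f g : Cc G) {x : UnitSpace G} (γ α : Fib x) :
    (f * g) (γ.1 * α.1⁻¹) = ∑' δ : Fib x, f (γ.1 * δ.1⁻¹) * g (δ.1 * α.1⁻¹) := by
  have h : ∀ (y : UnitSpace G) (_ : y = rng α.1), ∑' β : Fib y, f (γ.1 * α.1⁻¹ * β.1⁻¹) * g β.1 =
      ∑' δ : Fib x, f (γ.1 * δ.1⁻¹) * g (δ.1 * α.1⁻¹) := by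
    rintro y rfl
    rw [← (rdiv α).tsum_eq]
    refine tsum_congr fun δ => ?_
    have : γ.1 * α.1⁻¹ * (δ.1 * α.1⁻¹)⁻¹ = γ.1 * δ.1⁻¹ :=
      div_div_div (γ.2.trans α.2.symm) (δ.2.trans α.2.symm)
    change f (γ.1 * α.1⁻¹ * (δ.1 * α.1⁻¹)⁻¹) * g (δ.1 * α.1⁻¹) = _
    rw [this]
  exact h _ (src_div (γ.2.trans α.2.symm))

end Cc

end ConvolutionAlgebra

section RegularRepresentation

variable {G : Type*} [TopologicalSpace G] [EtaleGroupoid G]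

/-- The Hilbert space `ℓ²(G_x)`. -/
abbrev L2Fib (x : UnitSpace G) : Type _ := lp (fun _ : Fib x => ℂ) 2

/-- The point mass `δ_α ∈ ℓ²(G_x)`. -/
def delta {x : UnitSpace G} (α : Fib x) : L2Fib x := by
  classical exact lp.single 2 α 1

lemma delta_self {x : UnitSpace G} (α : Fib x) : delta α α = 1 := by
  classical
  simp [delta]

lemma delta_ne {x : UnitSpace G} {α β : Fib x} (h : β ≠ α) : delta α β = 0 := by
  classical
  simp [delta, h]

lemma norm_delta {x : UnitSpace G} (α : Fib x) : ‖delta α‖ = 1 := by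
  classical
  simp [delta, lp.norm_single]

/-- Operators on `ℓ²(G_x)` are determined by their matrix coefficients. -/
lemma clm_ext {x : UnitSpace G} {S T : L2Fib x →L[ℂ] L2Fib x}
    (h : ∀ α γ : Fib x, S (delta α) γ = T (delta α) γ) : S = T := by
  classical
  refine lp.ext_continuousLinearMap (by norm_num) fun α => ?_
  ext γ
  have := h α γ
  simpa [delta] using this

/-- The formula for the left regular representation at `x`:
`(λ_x(f)ξ)(γ) = ∑_{α ∈ G_x} f(γα⁻¹) ξ(α)`. -/
def lamFun (f : Cc G) {x : UnitSpace G} (ξ : Fib x → ℂ) (γ : Fib x) : ℂ :=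
  ∑' α : Fib x, f (γ.1 * α.1⁻¹) * ξ α

lemma lamFun_eq_sum (f : Cc G) {x : UnitSpace G} (ξ : Fib x → ℂ) (γ : Fib x) :
    lamFun f ξ γ = ∑ α ∈ (f.finite_div γ).toFinset, f (γ.1 * α.1⁻¹) * ξ α :=
  tsum_eq_sum fun α hα => by
    have : f (γ.1 * α.1⁻¹) = 0 := by simpa using hα
    rw [this, zero_mul]

lemma lamFun_bound (f : Cc G) : ∃ C : ℝ, 0 ≤ C ∧ ∀ (x : UnitSpace G) (ξ : L2Fib x)
    (s : Finset (Fib x)), ∑ γ ∈ s, ‖lamFun f ξ γ‖ ^ 2 ≤ (C * ‖ξ‖) ^ 2 := by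
  classical
  obtain ⟨N₁, h₁⟩ := f.exists_card_le'
  obtain ⟨N₂, h₂⟩ := f.exists_card_le''
  obtain ⟨M, hM0, hM⟩ := f.exists_norm_le
  refine ⟨√(N₁ * N₂) * M, by positivity, fun x ξ s => ?_⟩
  set A : Fib x → Finset (Fib x) := fun γ => (f.finite_div γ).toFinset with hA
  have hAmem : ∀ γ α, α ∈ A γ ↔ f (γ.1 * α.1⁻¹) ≠ 0 := fun γ α => by simp [hA]
  have hstep : ∀ γ, ‖lamFun f ξ γ‖ ^ 2 ≤ N₂ * M ^ 2 * ∑ α ∈ A γ, ‖ξ α‖ ^ 2 := by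
    intro γ
    have hc : ((A γ).card : ℝ) ≤ N₂ := by
      exact_mod_cast h₂ x γ (A γ) fun α hα => (hAmem γ α).1 hα
    have hn : ‖lamFun f ξ γ‖ ≤ M * ∑ α ∈ A γ, ‖ξ α‖ := by
      rw [lamFun_eq_sum, Finset.mul_sum]
      refine (norm_sum_le _ _).trans (Finset.sum_le_sum fun α _ => ?_)
      rw [norm_mul]
      exact mul_le_mul_of_nonneg_right (hM _) (norm_nonneg _)
    have hcs : (∑ α ∈ A γ, ‖ξ α‖) ^ 2 ≤ (A γ).card * ∑ α ∈ A γ, ‖ξ α‖ ^ 2 :=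
      sq_sum_le_card_mul_sum_sq
    have h0 : 0 ≤ ∑ α ∈ A γ, ‖ξ α‖ ^ 2 := Finset.sum_nonneg fun _ _ => by positivity
    calc ‖lamFun f ξ γ‖ ^ 2 ≤ (M * ∑ α ∈ A γ, ‖ξ α‖) ^ 2 := by gcongr
      _ = M ^ 2 * (∑ α ∈ A γ, ‖ξ α‖) ^ 2 := by ring
      _ ≤ M ^ 2 * (N₂ * ∑ α ∈ A γ, ‖ξ α‖ ^ 2) := by gcongr; exact hcs.trans (by gcongr)
      _ = _ := by ring
  have hswap : ∑ γ ∈ s, ∑ α ∈ A γ, ‖ξ α‖ ^ 2 ≤ N₁ * ‖ξ‖ ^ 2 := by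
    rw [Finset.sum_comm' (t' := s.biUnion A) (s' := fun α => s.filter fun γ => α ∈ A γ)]
    · have hle : ∀ α ∈ s.biUnion A, ∑ γ ∈ s.filter (fun γ => α ∈ A γ), ‖ξ α‖ ^ 2 ≤
          N₁ * ‖ξ α‖ ^ 2 := by
        intro α _
        rw [Finset.sum_const, nsmul_eq_mul]
        gcongr
        exact h₁ x α _ fun γ hγ => (hAmem γ α).1 (Finset.mem_filter.1 hγ).2
      refine (Finset.sum_le_sum hle).trans ?_
      rw [← Finset.mul_sum]
      gcongr
      have := lp.sum_rpow_le_norm_rpow (p := 2) (by norm_num) ξ (s.biUnion A)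
      simpa using this
    · intro γ α
      simp only [Finset.mem_biUnion, Finset.mem_filter]
      exact ⟨fun h => ⟨⟨h.1, h.2⟩, γ, h.1, h.2⟩, fun h => h.1⟩
  calc ∑ γ ∈ s, ‖lamFun f ξ γ‖ ^ 2
      ≤ ∑ γ ∈ s, N₂ * M ^ 2 * ∑ α ∈ A γ, ‖ξ α‖ ^ 2 := Finset.sum_le_sum fun γ _ => hstep γ
    _ = N₂ * M ^ 2 * ∑ γ ∈ s, ∑ α ∈ A γ, ‖ξ α‖ ^ 2 := by rw [Finset.mul_sum]
    _ ≤ N₂ * M ^ 2 * (N₁ * ‖ξ‖ ^ 2) := by gcongr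
    _ = (√(N₁ * N₂) * M * ‖ξ‖) ^ 2 := by
      rw [mul_pow, mul_pow, Real.sq_sqrt (by positivity)]; ring

lemma lamFun_memℓp (f : Cc G) {x : UnitSpace G} (ξ : L2Fib x) : Memℓp (lamFun f ξ) 2 := by
  obtain ⟨C, -, hC⟩ := lamFun_bound f
  exact memℓp_gen' (C := (C * ‖ξ‖) ^ 2) fun s => by simpa using hC x ξ s

/-- The left regular representation at `x`, `λ_x(f) ∈ B(ℓ²(G_x))`. -/
def lam (f : Cc G) (x : UnitSpace G) : L2Fib x →L[ℂ] L2Fib x :=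
  LinearMap.mkContinuousOfExistsBound
    { toFun := fun ξ => ⟨lamFun f ξ, lamFun_memℓp f ξ⟩
      map_add' := fun ξ η => by
        refine lp.ext (funext fun γ => ?_)
        change lamFun f (ξ + η : L2Fib x) γ = lamFun f ξ γ + lamFun f η γ
        simp only [lamFun_eq_sum, lp.coeFn_add, Pi.add_apply, mul_add, Finset.sum_add_distrib]
      map_smul' := fun c ξ => by
        refine lp.ext (funext fun γ => ?_)
        change lamFun f (c • ξ : L2Fib x) γ = c * lamFun f ξ γ
        simp only [lamFun_eq_sum, lp.coeFn_smul, Pi.smul_apply, smul_eq_mul, Finset.mul_sum]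
        exact Finset.sum_congr rfl fun α _ => by ring }
    (by
      obtain ⟨C, hC0, hC⟩ := lamFun_bound f
      exact ⟨C, fun ξ => lp.norm_le_of_forall_sum_le (by norm_num) (by positivity)
        fun s => by simpa using hC x ξ s⟩)

lemma lam_apply (f : Cc G) (x : UnitSpace G) (ξ : L2Fib x) (γ : Fib x) :
    lam f x ξ γ = ∑' α : Fib x, f (γ.1 * α.1⁻¹) * ξ α := rfl

lemma exists_norm_lam_le (f : Cc G) : ∃ C : ℝ, ∀ x, ‖lam f x‖ ≤ C := by
  obtain ⟨C, hC0, hC⟩ := lamFun_bound f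
  exact ⟨C, fun x => ContinuousLinearMap.opNorm_le_bound _ hC0 fun ξ =>
    lp.norm_le_of_forall_sum_le (by norm_num) (by positivity)
      fun s => by simpa [lam, lamFun] using hC x ξ s⟩

lemma lam_delta (f : Cc G) {x : UnitSpace G} (α γ : Fib x) :
    lam f x (delta α) γ = f (γ.1 * α.1⁻¹) := by
  rw [lam_apply, tsum_eq_single α fun β hβ => by rw [delta_ne hβ, mul_zero], delta_self, mul_one]

lemma lam_delta_unit (f : Cc G) {x : UnitSpace G} (γ : Fib x) :
    lam f x (delta (Fib.unit x)) γ = f γ.1 := by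
  have h := mul_src (x : G)
  rw [src_unit] at h
  have h1 : (x : G)⁻¹ = (x : G) := by
    have h2 := inv_mul_eq (x : G)
    rw [src_unit] at h2
    have h3 := mul_src ((x : G)⁻¹)
    rw [src_inv, rng_unit, h2] at h3
    exact h3.symm
  rw [lam_delta]
  change f (γ.1 * (x : G)⁻¹) = _
  have h4 := mul_src γ.1
  rw [γ.2] at h4
  rw [h1, h4]

lemma lam_add (f g : Cc G) (x : UnitSpace G) : lam (f + g) x = lam f x + lam g x :=
  clm_ext fun α γ => by
    change _ = lam f x (delta α) γ + lam g x (delta α) γ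
    simp only [lam_delta, Cc.add_apply]

lemma lam_smul (c : ℂ) (f : Cc G) (x : UnitSpace G) : lam (c • f) x = c • lam f x :=
  clm_ext fun α γ => by
    change _ = c * lam f x (delta α) γ
    simp only [lam_delta, Cc.smul_apply]

lemma lam_star (f : Cc G) (x : UnitSpace G) : lam (star f) x = star (lam f x) := by
  classical
  have hin : ∀ (S : L2Fib x →L[ℂ] L2Fib x) (α γ : Fib x),
      S (delta α) γ = inner ℂ (delta γ) (S (delta α)) := by
    intro S α γ
    rw [delta, delta, lp.inner_single_left]
    simp
  refine clm_ext fun α γ => ?_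
  rw [lam_delta, Cc.star_div f (γ.2.trans α.2.symm), hin, ContinuousLinearMap.star_eq_adjoint,
    ContinuousLinearMap.adjoint_inner_right, ← inner_conj_symm, ← hin, lam_delta]

variable (G) in
/-- The C⋆-algebra `∏_x B(ℓ²(G_x))` of uniformly bounded families, with pointwise operations and
the supremum norm. -/
def ProdB : Type _ := lp (fun x : UnitSpace G => L2Fib x →L[ℂ] L2Fib x) ∞

instance : NonUnitalCStarAlgebra (ProdB G) where
  toNonUnitalNormedRing := lp.nonUnitalNormedRing
  toStarRing := lp.inftyStarRing
  toCompleteSpace := lp.completeSpace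
  toCStarRing := lp.inftyCStarRing
  toNormedSpace := lp.instNormedSpace
  toIsScalarTower := lp.infty_isScalarTower
  toSMulCommClass := lp.infty_smulCommClass
  toStarModule := inferInstanceAs
    (StarModule ℂ (lp (fun x : UnitSpace G => L2Fib x →L[ℂ] L2Fib x) ∞))

namespace ProdB

/-- The component of a bounded family at `x`. -/
def app (T : ProdB G) (x : UnitSpace G) : L2Fib x →L[ℂ] L2Fib x := T.1 x

lemma ext {S T : ProdB G} (h : ∀ x, S.app x = T.app x) : S = T := lp.ext (funext h)

lemma norm_eq (T : ProdB G) : ‖T‖ = ⨆ x, ‖T.app x‖ := rfl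

lemma norm_app_le (T : ProdB G) (x : UnitSpace G) : ‖T.app x‖ ≤ ‖T‖ :=
  lp.norm_apply_le_norm (p := ∞) (by norm_num) T x

lemma add_app (S T : ProdB G) (x : UnitSpace G) : (S + T).app x = S.app x + T.app x := rfl
lemma smul_app (c : ℂ) (T : ProdB G) (x : UnitSpace G) : (c • T).app x = c • T.app x := rfl
lemma mul_app (S T : ProdB G) (x : UnitSpace G) : (S * T).app x = S.app x * T.app x := rfl
lemma star_app (T : ProdB G) (x : UnitSpace G) : (star T).app x = star (T.app x) := rfl
lemma zero_app (x : UnitSpace G) : (0 : ProdB G).app x = 0 := rfl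

end ProdB

lemma Cc.ext_lam {f g : Cc G} (h : ∀ x, lam f x = lam g x) : f = g := by
  ext γ
  rw [← lam_delta_unit f ⟨γ, rfl⟩, ← lam_delta_unit g ⟨γ, rfl⟩, h]

variable [T2Space G]

lemma lam_mul (f g : Cc G) (x : UnitSpace G) : lam (f * g) x = lam f x * lam g x :=
  clm_ext fun α γ => by
    rw [lam_delta, Cc.mul_div]
    change _ = lam f x (lam g x (delta α)) γ
    rw [lam_apply]
    exact tsum_congr fun δ => by rw [lam_delta]

instance : NonUnitalRing (Cc G) :=
  { (inferInstance : AddCommGroup (Cc G)), (inferInstance : Mul (Cc G)) with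
    left_distrib := fun f g h => Cc.ext_lam fun x => by simp only [lam_add, lam_mul, mul_add]
    right_distrib := fun f g h => Cc.ext_lam fun x => by simp only [lam_add, lam_mul, add_mul]
    zero_mul := fun f => by ext γ; simp [Cc.mul_apply]
    mul_zero := fun f => by ext γ; simp [Cc.mul_apply]
    mul_assoc := fun f g h => Cc.ext_lam fun x => by simp only [lam_mul, mul_assoc] }

instance : StarRing (Cc G) where
  star_involutive f := by ext γ; simp [Cc.star_apply, inv_inv']
  star_mul f g := Cc.ext_lam fun x => by simp only [lam_star, lam_mul, star_mul]
  star_add f g := by ext γ; simp [Cc.star_apply]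

instance : StarModule ℂ (Cc G) where
  star_smul c f := by ext γ; simp [Cc.star_apply]

instance : IsScalarTower ℂ (Cc G) (Cc G) where
  smul_assoc c f g := Cc.ext_lam fun x => by
    simp only [smul_eq_mul, lam_mul, lam_smul, smul_mul_assoc]

instance : SMulCommClass ℂ (Cc G) (Cc G) where
  smul_comm c f g := Cc.ext_lam fun x => by
    simp only [smul_eq_mul, lam_mul, lam_smul, mul_smul_comm]

variable (G) in
/-- The ⋆-homomorphism `f ↦ (λ_x(f))_x` from `C_c(G)` to `∏_x B(ℓ²(G_x))`. -/
def lamHom : Cc G →⋆ₙₐ[ℂ] ProdB G where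
  toFun f := ⟨lam f, memℓp_infty (by
    obtain ⟨C, hC⟩ := exists_norm_lam_le f
    exact ⟨C, by rintro _ ⟨x, rfl⟩; exact hC x⟩)⟩
  map_smul' c f := ProdB.ext fun x => lam_smul c f x
  map_zero' := ProdB.ext fun x => by
    have := lam_smul (0 : ℂ) (0 : Cc G) x
    rw [zero_smul, zero_smul] at this
    exact this
  map_add' f g := ProdB.ext fun x => lam_add f g x
  map_mul' f g := ProdB.ext fun x => lam_mul f g x
  map_star' f := ProdB.ext fun x => lam_star f x

lemma lamHom_apply (f : Cc G) (x : UnitSpace G) : (lamHom G f).app x = lam f x := rfl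

lemma lamHom_injective : Function.Injective (lamHom G) := fun f g h => Cc.ext_lam fun x => by
  rw [← lamHom_apply, h, lamHom_apply]

/-- The reduced norm `‖f‖_r = sup_x ‖λ_x(f)‖` on `C_c(G)`. -/
def reducedNorm (f : Cc G) : ℝ := ⨆ x : UnitSpace G, ‖lam f x‖

lemma norm_lamHom (f : Cc G) : ‖lamHom G f‖ = reducedNorm f := rfl

variable (G) in
/-- The reduced groupoid C⋆-algebra `C*_r(G)`: the completion of `C_c(G)` in the reduced norm,
realised as the closure of the image of `C_c(G)` under the isometric (for the reduced norm)
injective ⋆-homomorphism `f ↦ (λ_x(f))_x` into the complete C⋆-algebra `∏_x B(ℓ²(G_x))`. -/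
def ReducedCStar : NonUnitalStarSubalgebra ℂ (ProdB G) :=
  (NonUnitalStarAlgHom.range (lamHom G)).topologicalClosure

end RegularRepresentation

section HilbertModule

variable {G : Type*} [TopologicalSpace G] [EtaleGroupoid G]

variable (G) in
/-- The Banach space `∏_x ℓ²(G_x)` of uniformly bounded families, with the supremum norm. -/
def ProdL2 : Type _ := lp (fun x : UnitSpace G => L2Fib x) ∞

instance : NormedAddCommGroup (ProdL2 G) := lp.normedAddCommGroup
instance : NormedSpace ℂ (ProdL2 G) := lp.instNormedSpace
instance : CompleteSpace (ProdL2 G) := lp.completeSpace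

namespace ProdL2

/-- The component of a bounded family at `x`. -/
def app (ξ : ProdL2 G) (x : UnitSpace G) : L2Fib x := ξ.1 x

@[ext] lemma ext {ξ η : ProdL2 G} (h : ∀ x, ξ.app x = η.app x) : ξ = η := lp.ext (funext h)

lemma norm_eq (ξ : ProdL2 G) : ‖ξ‖ = ⨆ x, ‖ξ.app x‖ := rfl

lemma norm_app_le (ξ : ProdL2 G) (x : UnitSpace G) : ‖ξ.app x‖ ≤ ‖ξ‖ :=
  lp.norm_apply_le_norm (p := ∞) (by norm_num) ξ x

lemma norm_le {ξ : ProdL2 G} {C : ℝ} (hC : 0 ≤ C) (h : ∀ x, ‖ξ.app x‖ ≤ C) : ‖ξ‖ ≤ C :=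
  lp.norm_le_of_forall_le hC h

@[simp] lemma add_app (ξ η : ProdL2 G) (x : UnitSpace G) : (ξ + η).app x = ξ.app x + η.app x := rfl
@[simp] lemma sub_app (ξ η : ProdL2 G) (x : UnitSpace G) : (ξ - η).app x = ξ.app x - η.app x := rfl
@[simp] lemma smul_app (c : ℂ) (ξ : ProdL2 G) (x : UnitSpace G) : (c • ξ).app x = c • ξ.app x := rfl
@[simp] lemma zero_app (x : UnitSpace G) : (0 : ProdL2 G).app x = 0 := rfl

/-- A family of vectors `ξ_x ∈ ℓ²(G_x)` with `‖ξ_x‖ ≤ C` for all `x`. -/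
def mk (ξ : ∀ x : UnitSpace G, L2Fib x) (C : ℝ) (h : ∀ x, ‖ξ x‖ ≤ C) : ProdL2 G :=
  (⟨ξ, memℓp_infty ⟨C, by rintro _ ⟨x, rfl⟩; exact h x⟩⟩ :
    lp (fun x : UnitSpace G => L2Fib x) ∞)

@[simp] lemma mk_app (ξ : ∀ x : UnitSpace G, L2Fib x) (C : ℝ) (h : ∀ x, ‖ξ x‖ ≤ C)
    (x : UnitSpace G) : (mk ξ C h).app x = ξ x := rfl

end ProdL2

/-- The diagonal operator `(ξ_x)_x ↦ (T_x ξ_x)_x` on `∏_x ℓ²(G_x)`. -/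
def diag (T : ProdB G) : ProdL2 G →L[ℂ] ProdL2 G :=
  LinearMap.mkContinuous
    { toFun := fun ξ => ProdL2.mk (fun x => T.app x (ξ.app x)) (‖T‖ * ‖ξ‖) fun x =>
        (T.app x).le_of_opNorm_le_of_le (T.norm_app_le x) (ξ.norm_app_le x)
      map_add' := fun ξ η => ProdL2.ext fun x => map_add (T.app x) _ _
      map_smul' := fun c ξ => ProdL2.ext fun x => map_smul (T.app x) _ _ }
    ‖T‖ fun ξ => ProdL2.norm_le (by positivity) fun x =>
      (T.app x).le_of_opNorm_le_of_le (T.norm_app_le x) (ξ.norm_app_le x)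

@[simp] lemma diag_app (T : ProdB G) (ξ : ProdL2 G) (x : UnitSpace G) :
    (diag T ξ).app x = T.app x (ξ.app x) := rfl

lemma restrict_memℓp (f : Cc G) (x : UnitSpace G) : Memℓp (fun γ : Fib x => f γ.1) 2 := by
  have h := lp.memℓp (lam f x (delta (Fib.unit x)))
  have : (lam f x (delta (Fib.unit x)) : Fib x → ℂ) = fun γ : Fib x => f γ.1 :=
    funext fun γ => lam_delta_unit f γ
  rwa [← this]

/-- The restriction `f|_{G_x} ∈ ℓ²(G_x)` of `f ∈ C_c(G)`. -/
def restrict (f : Cc G) (x : UnitSpace G) : L2Fib x := ⟨fun γ => f γ.1, restrict_memℓp f x⟩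

@[simp] lemma restrict_apply (f : Cc G) (x : UnitSpace G) (γ : Fib x) : restrict f x γ = f γ.1 :=
  rfl

lemma exists_norm_restrict_le (f : Cc G) : ∃ C : ℝ, ∀ x, ‖restrict f x‖ ≤ C := by
  obtain ⟨C, hC⟩ := exists_norm_lam_le f
  refine ⟨C, fun x => ?_⟩
  have : restrict f x = lam f x (delta (Fib.unit x)) :=
    lp.ext (funext fun γ => (lam_delta_unit f γ).symm)
  rw [this]
  have h := (lam f x).le_of_opNorm_le (hC x) (delta (Fib.unit x))
  rwa [norm_delta, mul_one] at h

variable (G) in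
/-- The linear map `f ↦ (f|_{G_x})_x` from `C_c(G)` to `∏_x ℓ²(G_x)`. It is injective, and the
norm it induces on `C_c(G)` is `‖f‖² = sup_x ∑_{γ ∈ G_x} |f(γ)|²`. -/
def slice : Cc G →ₗ[ℂ] ProdL2 G where
  toFun f := ProdL2.mk (restrict f) (exists_norm_restrict_le f).choose
    (exists_norm_restrict_le f).choose_spec
  map_add' _ _ := rfl
  map_smul' _ _ := rfl

@[simp] lemma slice_app (f : Cc G) (x : UnitSpace G) (γ : Fib x) : (slice G f).app x γ = f γ.1 :=
  rfl

variable (G) in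
/-- The Hilbert module `L²(G)`: the completion of `C_c(G)` for the norm
`‖f‖² = sup_x ∑_{γ ∈ G_x} |f(γ)|²`, realised as the closure of `C_c(G)` in the Banach space
`∏_x ℓ²(G_x)`. -/
def L2 : Submodule ℂ (ProdL2 G) := (LinearMap.range (slice G)).topologicalClosure

instance : CompleteSpace (L2 G) :=
  (Submodule.isClosed_topologicalClosure (LinearMap.range (slice G))).completeSpace_coe

lemma slice_mem (f : Cc G) : slice G f ∈ L2 G :=
  Submodule.le_topologicalClosure _ ⟨f, rfl⟩

variable (G) in
/-- The inclusion of `C_c(G)` in `L²(G)`. -/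
def toL2 : Cc G →ₗ[ℂ] L2 G := (slice G).codRestrict (L2 G) slice_mem

/-- The value of `ξ ∈ L²(G)` at `γ`; this regards `L²(G)` as a space of functions on `G`. -/
def L2val (ξ : L2 G) (γ : G) : ℂ := ξ.1.app (src γ) ⟨γ, rfl⟩

lemma L2_app_apply (ξ : L2 G) (x : UnitSpace G) (γ : Fib x) : ξ.1.app x γ = L2val ξ γ.1 := by
  obtain ⟨γ, rfl⟩ := γ
  rfl

lemma L2_ext {ξ η : L2 G} (h : ∀ γ, L2val ξ γ = L2val η γ) : ξ = η :=
  Subtype.ext (ProdL2.ext fun x => lp.ext (funext fun γ => by rw [L2_app_apply, L2_app_apply, h]))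

lemma L2val_toL2 (f : Cc G) (γ : G) : L2val (toL2 G f) γ = f γ := rfl

lemma exists_slice_near {ξ : ProdL2 G} (hξ : ξ ∈ L2 G) {ε : ℝ} (hε : 0 < ε) :
    ∃ f : Cc G, ‖ξ - slice G f‖ < ε := by
  obtain ⟨_, ⟨f, rfl⟩, hf⟩ := Metric.mem_closure_iff.1 hξ ε hε
  exact ⟨f, by rwa [← dist_eq_norm]⟩

/-- A bounded operator on `∏_x ℓ²(G_x)` that maps `C_c(G)` into `L²(G)` restricts to `L²(G)`. -/
def restrictL2 (S : ProdL2 G →L[ℂ] ProdL2 G) (hS : ∀ f, S (slice G f) ∈ L2 G) : L2 G →L[ℂ] L2 G :=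
  (S.comp (L2 G).subtypeL).codRestrict (L2 G) fun ξ => by
    have h : Set.MapsTo S (LinearMap.range (slice G) : Set (ProdL2 G)) (L2 G) := by
      rintro _ ⟨f, rfl⟩
      exact hS f
    have h2 := h.closure S.continuous
    have h3 : IsClosed (L2 G : Set (ProdL2 G)) := Submodule.isClosed_topologicalClosure _
    rw [h3.closure_eq] at h2
    exact h2 ξ.2

@[simp] lemma restrictL2_coe (S : ProdL2 G →L[ℂ] ProdL2 G) (hS : ∀ f, S (slice G f) ∈ L2 G)
    (ξ : L2 G) : (restrictL2 S hS ξ : ProdL2 G) = S ξ := rfl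

/-- The pointwise order on `C₀(G⁰)`. -/
instance : PartialOrder C₀(UnitSpace G, ℂ) := PartialOrder.lift (fun f => (f : UnitSpace G → ℂ))
  DFunLike.coe_injective

lemma inner_slice (f g : Cc G) (x : UnitSpace G) :
    inner ℂ ((slice G f).app x) ((slice G g).app x) = ∑' γ : Fib x, conj (f γ.1) * g γ.1 := by
  rw [lp.inner_eq_tsum]
  exact tsum_congr fun γ => by simp [mul_comm]

lemma norm_inner_sub_le {ξ η ξ' η' : ProdL2 G} {ε : ℝ} (h1 : ‖ξ - ξ'‖ ≤ ε) (h2 : ‖η - η'‖ ≤ ε)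
    (x : UnitSpace G) :
    ‖inner ℂ (ξ.app x) (η.app x) - inner ℂ (ξ'.app x) (η'.app x)‖ ≤
      ε * ‖η‖ + (‖ξ‖ + ε) * ε := by
  have hε : 0 ≤ ε := (norm_nonneg _).trans h1
  have e1 : inner ℂ (ξ.app x) (η.app x) - inner ℂ (ξ'.app x) (η'.app x) =
      inner ℂ ((ξ - ξ').app x) (η.app x) + inner ℂ (ξ'.app x) ((η - η').app x) := by
    simp only [ProdL2.sub_app, inner_sub_left, inner_sub_right]; ring
  have e2 : ‖ξ'‖ ≤ ‖ξ‖ + ε := by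
    have : ξ' = ξ - (ξ - ξ') := by abel
    rw [this]
    exact (norm_sub_le _ _).trans (by gcongr)
  rw [e1]
  refine (norm_add_le _ _).trans (add_le_add ?_ ?_)
  · refine (norm_inner_le_norm _ _).trans ?_
    have a := (ProdL2.norm_app_le (ξ - ξ') x).trans h1
    have b := ProdL2.norm_app_le η x
    gcongr
  · refine (norm_inner_le_norm _ _).trans ?_
    have a := (ProdL2.norm_app_le ξ' x).trans e2
    have b := (ProdL2.norm_app_le (η - η') x).trans h2
    gcongr

lemma exists_delta_inner (ξ η : L2 G) {ε : ℝ} (hε : 0 < ε) : ∃ f g : Cc G, ∀ x,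
    ‖inner ℂ (ξ.1.app x) (η.1.app x) - inner ℂ ((slice G f).app x) ((slice G g).app x)‖ < ε := by
  have ht : Tendsto (fun δ : ℝ => δ * ‖η.1‖ + (‖ξ.1‖ + δ) * δ) (𝓝[>] 0) (𝓝 0) := by
    have : Continuous fun δ : ℝ => δ * ‖η.1‖ + (‖ξ.1‖ + δ) * δ := by fun_prop
    have h := this.tendsto 0
    simp only [zero_mul, mul_zero, add_zero] at h
    exact h.mono_left nhdsWithin_le_nhds
  obtain ⟨δ, hδ, hδ0⟩ := ((ht.eventually (gt_mem_nhds hε)).and self_mem_nhdsWithin).exists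
  obtain ⟨f, hf⟩ := exists_slice_near ξ.2 hδ0
  obtain ⟨g, hg⟩ := exists_slice_near η.2 hδ0
  exact ⟨f, g, fun x => (norm_inner_sub_le hf.le hg.le x).trans_lt hδ⟩

section InnerProduct

variable [T2Space G]

lemma continuous_inner_slice (f g : Cc G) :
    Continuous fun x => inner ℂ ((slice G f).app x) ((slice G g).app x) := by
  simp only [inner_slice]
  rw [continuous_iff_continuousAt]
  intro x₀
  refine continuousAt_tsum (p := fun x => x) continuousAt_id g.isCompact
    (fun _ γ => conj (f γ) * g γ) (fun x γ _ h => by rw [Cc.eq_zero_of_notMem h, mul_zero]) ?_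
  intro γ _
  have : Continuous fun q : UnitSpace G × G => conj (f q.2) * g q.2 :=
    (Complex.continuous_conj.comp (f.continuous.comp continuous_snd)).mul
      (g.continuous.comp continuous_snd)
  exact (this.tendsto (x₀, γ)).mono_left nhdsWithin_le_nhds

/-- The `C₀(G⁰)`-valued inner product on `L²(G)`:
`⟨ξ, η⟩(x) = ⟨ξ|_{G_x}, η|_{G_x}⟩ = ∑_{γ ∈ G_x} conj (ξ(γ)) η(γ)`. -/
def baseInner (ξ η : L2 G) : C₀(UnitSpace G, ℂ) where
  toFun x := inner ℂ (ξ.1.app x) (η.1.app x)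
  continuous_toFun := by
    refine continuous_of_uniform_approx_of_continuous fun u hu => ?_
    obtain ⟨ε, hε, hu⟩ := Metric.mem_uniformity_dist.1 hu
    obtain ⟨f, g, h⟩ := exists_delta_inner ξ η hε
    exact ⟨_, continuous_inner_slice f g, fun x => hu (by rw [dist_eq_norm]; exact h x)⟩
  zero_at_infty' := by
    rw [Metric.tendsto_nhds]
    intro ε hε
    obtain ⟨f, g, h⟩ := exists_delta_inner ξ η hε
    have hK : IsCompact (src '' tsupport f : Set (UnitSpace G)) :=
      f.isCompact.image continuous_src
    filter_upwards [hK.compl_mem_cocompact] with x hx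
    have h0 : inner ℂ ((slice G f).app x) ((slice G g).app x) = 0 := by
      have hz : (slice G f).app x = 0 := by
        refine lp.ext (funext fun γ => ?_)
        change f γ.1 = 0
        exact Cc.eq_zero_of_notMem fun hγ => hx ⟨γ.1, hγ, γ.2⟩
      rw [hz, inner_zero_left]
    have := h x
    rwa [h0, sub_zero, ← dist_zero_right] at this

lemma baseInner_app (ξ η : L2 G) (x : UnitSpace G) :
    baseInner ξ η x = inner ℂ (ξ.1.app x) (η.1.app x) := rfl

end InnerProduct

lemma fibMul_mem (a : C₀(UnitSpace G, ℂ)) (f : Cc G) :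
    ∃ g : Cc G, ∀ γ, g γ = a (src γ) * f γ :=
  ⟨Cc.mk (fun γ => a (src γ) * f γ)
    ((a.continuous.comp continuous_src).mul f.continuous)
    (HasCompactSupport.mul_left f.hasCompactSupport'), fun _ => rfl⟩

/-- The action of `C₀(G⁰)` on `∏_x ℓ²(G_x)`: `(ξ a)_x = ξ_x a(x)`. -/
def baseMul (a : C₀(UnitSpace G, ℂ)) : ProdL2 G →L[ℂ] ProdL2 G :=
  have h : ∀ (ξ : ProdL2 G) (x : UnitSpace G), ‖a x • ξ.app x‖ ≤ ‖a‖ * ‖ξ‖ := fun ξ x => by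
    rw [norm_smul]
    have h1 : ‖a x‖ ≤ ‖a‖ := a.toBCF.norm_coe_le_norm x
    have h2 := ξ.norm_app_le x
    gcongr
  LinearMap.mkContinuous
    { toFun := fun ξ => ProdL2.mk (fun x => a x • ξ.app x) (‖a‖ * ‖ξ‖) (h ξ)
      map_add' := fun ξ η => ProdL2.ext fun x => smul_add (a x) _ _
      map_smul' := fun c ξ => ProdL2.ext fun x => smul_comm (a x) c (ξ.app x) }
    ‖a‖ fun ξ => ProdL2.norm_le (by positivity) (h ξ)

/-- The right action of (the commutative algebra) `C₀(G⁰)` on `L²(G)`: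
`(ξ a)(γ) = ξ(γ) a(s(γ))`. -/
instance : SMul C₀(UnitSpace G, ℂ) (L2 G) where
  smul a ξ := restrictL2 (baseMul a) (fun f => by
    obtain ⟨g, hg⟩ := fibMul_mem a f
    have : baseMul a (slice G f) = slice G g :=
      ProdL2.ext fun x => lp.ext (funext fun γ => by
        change a x * f γ.1 = g γ.1
        rw [hg, γ.2])
    rw [this]
    exact slice_mem g) ξ

lemma base_smul_app (a : C₀(UnitSpace G, ℂ)) (ξ : L2 G) (x : UnitSpace G) :
    (a • ξ).1.app x = a x • ξ.1.app x := rfl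

/-- `L²(G)` is a Hilbert C⋆-module over `C₀(G⁰)`. -/
instance [T2Space G] : CStarModule C₀(UnitSpace G, ℂ) (L2 G) where
  inner := baseInner
  inner_add_right {ξ η ζ} := by
    ext x
    exact inner_add_right (ξ.1.app x) (η.1.app x) (ζ.1.app x)
  inner_self_nonneg {ξ} := fun x => by
    change (0 : ℂ) ≤ inner ℂ (ξ.1.app x) (ξ.1.app x)
    rw [inner_self_eq_norm_sq_to_K]
    simp
  inner_self {ξ} := by
    refine ⟨fun h => Subtype.ext (ProdL2.ext fun x => ?_), fun h => ?_⟩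
    · exact inner_self_eq_zero.1 (DFunLike.congr_fun h x)
    · subst h
      ext x
      exact inner_zero_left (𝕜 := ℂ) ((0 : ProdL2 G).app x)
  inner_op_smul_right {a ξ η} := by
    ext x
    exact inner_smul_right (ξ.1.app x) (η.1.app x) (a x)
  inner_smul_right_complex {c ξ η} := by
    ext x
    exact inner_smul_right (ξ.1.app x) (η.1.app x) c
  star_inner ξ η := by
    ext x
    exact inner_conj_symm (η.1.app x) (ξ.1.app x)
  norm_eq_sqrt_norm_inner_self ξ := by
    have h : ∀ x, ‖baseInner ξ ξ x‖ = ‖ξ.1.app x‖ ^ 2 := fun x => by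
      rw [baseInner_app, inner_self_eq_norm_sq_to_K]
      simp
    refine le_antisymm (ProdL2.norm_le (ξ := ξ.1) (Real.sqrt_nonneg _) fun x => ?_) ?_
    · refine Real.le_sqrt_of_sq_le ?_
      refine (h x).ge.trans ?_
      exact (baseInner ξ ξ).toBCF.norm_coe_le_norm x
    · rw [Real.sqrt_le_left (norm_nonneg _)]
      refine (BoundedContinuousFunction.norm_le (sq_nonneg _)).2 fun x => ?_
      refine (h x).le.trans ?_
      have := ξ.1.norm_app_le x
      exact pow_le_pow_left₀ (norm_nonneg _) this 2

section InnerLemmas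

variable [T2Space G] (ξ η ζ : L2 G)

lemma inner_app (x : UnitSpace G) :
    inner C₀(UnitSpace G, ℂ) ξ η x = inner ℂ (ξ.1.app x) (η.1.app x) := rfl

lemma ip_add_right : inner C₀(UnitSpace G, ℂ) ζ (ξ + η) =
    inner C₀(UnitSpace G, ℂ) ζ ξ + inner C₀(UnitSpace G, ℂ) ζ η := CStarModule.inner_add_right

lemma ip_add_left : inner C₀(UnitSpace G, ℂ) (ξ + η) ζ =
    inner C₀(UnitSpace G, ℂ) ξ ζ + inner C₀(UnitSpace G, ℂ) η ζ := CStarModule.inner_add_left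

lemma ip_sub_right : inner C₀(UnitSpace G, ℂ) ζ (ξ - η) =
    inner C₀(UnitSpace G, ℂ) ζ ξ - inner C₀(UnitSpace G, ℂ) ζ η := CStarModule.inner_sub_right

lemma ip_smul_right (c : ℂ) : inner C₀(UnitSpace G, ℂ) ζ (c • ξ) =
    c • inner C₀(UnitSpace G, ℂ) ζ ξ := CStarModule.inner_smul_right_complex

lemma ip_smul_left (c : ℂ) : inner C₀(UnitSpace G, ℂ) (c • ξ) ζ =
    star c • inner C₀(UnitSpace G, ℂ) ξ ζ := CStarModule.inner_smul_left_complex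

lemma ip_star : star (inner C₀(UnitSpace G, ℂ) ξ η) = inner C₀(UnitSpace G, ℂ) η ξ :=
  CStarModule.star_inner ξ η

end InnerLemmas

end HilbertModule

section Adjointable

variable {G : Type*} [TopologicalSpace G] [EtaleGroupoid G] [T2Space G]

/-- A map `T : L²(G) → L²(G)` is adjointable if there is a map `S` with `⟨η, Tξ⟩ = ⟨Sη, ξ⟩` for
all `ξ, η`. -/
def IsAdjointable (T : L2 G → L2 G) : Prop :=
  ∃ S : L2 G → L2 G, ∀ ξ η : L2 G,
    inner C₀(UnitSpace G, ℂ) η (T ξ) = inner C₀(UnitSpace G, ℂ) (S η) ξ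

lemma L2_ext_inner {ξ η : L2 G} (h : ∀ ζ : L2 G,
    inner C₀(UnitSpace G, ℂ) ζ ξ = inner C₀(UnitSpace G, ℂ) ζ η) : ξ = η := by
  refine sub_eq_zero.1 ((CStarModule.inner_self (A := C₀(UnitSpace G, ℂ))).1 ?_)
  rw [ip_sub_right, h, sub_self]

/-- An adjointable map is automatically linear and bounded. -/
lemma IsAdjointable.exists_clm {T : L2 G → L2 G} (hT : IsAdjointable T) :
    ∃ T' : L2 G →L[ℂ] L2 G, ⇑T' = T := by
  obtain ⟨S, hS⟩ := hT
  let L : L2 G →ₗ[ℂ] L2 G :=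
    { toFun := T
      map_add' := fun ξ η => L2_ext_inner fun ζ => by
        rw [hS, ip_add_right, ip_add_right, hS, hS]
      map_smul' := fun c ξ => L2_ext_inner fun ζ => by
        rw [hS, ip_smul_right, RingHom.id_apply,
          ip_smul_right, hS] }
  have hcont : ∀ (ζ : L2 G) (x : UnitSpace G),
      Continuous fun ξ : L2 G => inner ℂ (ζ.1.app x) (ξ.1.app x) := by
    intro ζ x
    refine LipschitzWith.continuous (K := ‖ζ.1.app x‖₊) (LipschitzWith.of_dist_le_mul ?_)
    intro ξ η
    rw [dist_eq_norm, dist_eq_norm, ← inner_sub_right]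
    refine (norm_inner_le_norm _ _).trans ?_
    have : ‖ξ.1.app x - η.1.app x‖ ≤ ‖ξ - η‖ := (ξ.1 - η.1).norm_app_le x
    rw [coe_nnnorm]
    gcongr
  refine ⟨⟨L, L.continuous_of_seq_closed_graph fun u ξ η hu hTu => ?_⟩, rfl⟩
  refine L2_ext_inner fun ζ => ?_
  ext x
  have h1 := ((hcont ζ x).tendsto η).comp hTu
  have h2 := ((hcont (S ζ) x).tendsto ξ).comp hu
  have h3 : ∀ n, inner ℂ (ζ.1.app x) ((T (u n)).1.app x) =
      inner ℂ ((S ζ).1.app x) ((u n).1.app x) := fun n => DFunLike.congr_fun (hS (u n) ζ) x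
  have h4 : inner ℂ (ζ.1.app x) (η.1.app x) = inner ℂ ((S ζ).1.app x) (ξ.1.app x) :=
    tendsto_nhds_unique h1 (h2.congr fun n => (h3 n).symm)
  exact h4.trans (DFunLike.congr_fun (hS ξ ζ) x).symm

variable (G) in
/-- The algebra `𝓛(L²(G))` of adjointable operators on `L²(G)`, with the operator norm. -/
def adjSubalgebra : Subalgebra ℂ (L2 G →L[ℂ] L2 G) where
  carrier := {T | IsAdjointable T}
  mul_mem' := by
    rintro T T' ⟨S, hS⟩ ⟨S', hS'⟩
    exact ⟨S' ∘ S, fun ξ η => (hS (T' ξ) η).trans (hS' ξ (S η))⟩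
  add_mem' := by
    rintro T T' ⟨S, hS⟩ ⟨S', hS'⟩
    refine ⟨fun η => S η + S' η, fun ξ η => ?_⟩
    rw [ip_add_left, ← hS, ← hS', ← ip_add_right]
    rfl
  algebraMap_mem' c := by
    refine ⟨fun η => conj c • η, fun ξ η => ?_⟩
    ext x
    have h1 := inner_smul_right (𝕜 := ℂ) (η.1.app x) (ξ.1.app x) c
    have h2 := inner_smul_left (𝕜 := ℂ) (η.1.app x) (ξ.1.app x) (conj c)
    rw [Complex.conj_conj] at h2
    exact h1.trans h2.symm

/-- The adjoint of an adjointable operator, as a map. -/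
def adjFun (T : adjSubalgebra G) : L2 G → L2 G := T.2.choose

lemma inner_adjFun (T : adjSubalgebra G) (ξ η : L2 G) : inner C₀(UnitSpace G, ℂ) η (T.1 ξ) =
    inner C₀(UnitSpace G, ℂ) (adjFun T η) ξ := T.2.choose_spec ξ η

lemma inner_adjFun' (T : adjSubalgebra G) (ξ η : L2 G) : inner C₀(UnitSpace G, ℂ) ξ (adjFun T η) =
    inner C₀(UnitSpace G, ℂ) (T.1 ξ) η := by
  rw [← ip_star, ← inner_adjFun, ip_star]

lemma norm_sq_le_of_inner {ξ η ζ : L2 G}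
    (h : inner C₀(UnitSpace G, ℂ) ξ ξ = inner C₀(UnitSpace G, ℂ) η ζ) :
    ‖ξ‖ ^ 2 ≤ ‖η‖ * ‖ζ‖ := by
  rw [CStarModule.norm_sq_eq C₀(UnitSpace G, ℂ), h]
  refine (BoundedContinuousFunction.norm_le (by positivity)).2 fun x => ?_
  refine (norm_inner_le_norm (𝕜 := ℂ) (η.1.app x) (ζ.1.app x)).trans ?_
  have h1 : ‖η.1.app x‖ ≤ ‖η‖ := η.1.norm_app_le x
  have h2 : ‖ζ.1.app x‖ ≤ ‖ζ‖ := ζ.1.norm_app_le x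
  gcongr

lemma norm_adjFun_le (T : adjSubalgebra G) (η : L2 G) : ‖adjFun T η‖ ≤ ‖T‖ * ‖η‖ := by
  have h := norm_sq_le_of_inner (inner_adjFun T (adjFun T η) η).symm
  have h2 : ‖T.1 (adjFun T η)‖ ≤ ‖T‖ * ‖adjFun T η‖ := T.1.le_opNorm _
  rcases (norm_nonneg (adjFun T η)).eq_or_lt' with h0 | h0
  · rw [h0]; positivity
  · refine le_of_mul_le_mul_right ?_ h0
    calc ‖adjFun T η‖ * ‖adjFun T η‖ = ‖adjFun T η‖ ^ 2 := by ring
      _ ≤ ‖η‖ * (‖T‖ * ‖adjFun T η‖) := h.trans (by gcongr)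
      _ = _ := by ring

/-- The adjoint `T*` of an adjointable operator `T`. -/
def adj (T : adjSubalgebra G) : adjSubalgebra G :=
  ⟨LinearMap.mkContinuous
    { toFun := adjFun T
      map_add' := fun ξ η => L2_ext_inner fun ζ => by
        rw [inner_adjFun', ip_add_right, ip_add_right,
          inner_adjFun', inner_adjFun']
      map_smul' := fun c ξ => L2_ext_inner fun ζ => by
        rw [inner_adjFun', ip_smul_right, RingHom.id_apply,
          ip_smul_right, inner_adjFun'] }
    ‖T‖ (norm_adjFun_le T), T.1, fun ξ η => inner_adjFun' T η ξ⟩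

instance : Star (adjSubalgebra G) := ⟨adj⟩

/-- The defining property of the adjoint. -/
lemma inner_star (T : adjSubalgebra G) (ξ η : L2 G) : inner C₀(UnitSpace G, ℂ) η (T.1 ξ) =
    inner C₀(UnitSpace G, ℂ) ((star T).1 η) ξ := inner_adjFun T ξ η

lemma inner_star' (T : adjSubalgebra G) (ξ η : L2 G) : inner C₀(UnitSpace G, ℂ) η ((star T).1 ξ) =
    inner C₀(UnitSpace G, ℂ) (T.1 η) ξ := inner_adjFun' T η ξ

lemma adjSubalgebra_ext {S T : adjSubalgebra G} (h : ∀ ξ η : L2 G,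
    inner C₀(UnitSpace G, ℂ) η (S.1 ξ) = inner C₀(UnitSpace G, ℂ) η (T.1 ξ)) : S = T :=
  Subtype.ext (ContinuousLinearMap.ext fun ξ => L2_ext_inner fun η => h ξ η)

lemma eq_star {S T : adjSubalgebra G} (h : ∀ ξ η : L2 G,
    inner C₀(UnitSpace G, ℂ) η (S.1 ξ) = inner C₀(UnitSpace G, ℂ) (T.1 η) ξ) : S = star T :=
  adjSubalgebra_ext fun ξ η => by rw [h, inner_star']

lemma norm_star_le (T : adjSubalgebra G) : ‖star T‖ ≤ ‖T‖ :=
  ContinuousLinearMap.opNorm_le_bound _ (norm_nonneg _) (norm_adjFun_le T)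

instance : StarRing (adjSubalgebra G) where
  star_involutive T := (eq_star fun ξ η => inner_star T ξ η).symm
  star_mul S T := (eq_star fun ξ η => by
    change inner _ η ((star T).1 ((star S).1 ξ)) = inner _ (S.1 (T.1 η)) ξ
    rw [inner_star', inner_star']).symm
  star_add S T := (eq_star fun ξ η => by
    change inner _ η ((star S).1 ξ + (star T).1 ξ) = inner _ (S.1 η + T.1 η) ξ
    rw [ip_add_right, ip_add_left, inner_star', inner_star']).symm

instance : StarModule ℂ (adjSubalgebra G) where
  star_smul c T := (eq_star fun ξ η => by
    change inner _ η (star c • (star T).1 ξ) = inner _ (c • T.1 η) ξ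
    rw [ip_smul_right, ip_smul_left,
      inner_star']).symm

instance : NormedStarGroup (adjSubalgebra G) where
  norm_star_le := norm_star_le

instance : CStarRing (adjSubalgebra G) where
  norm_mul_self_le T := by
    rw [← Real.sqrt_le_sqrt_iff (norm_nonneg _), Real.sqrt_mul_self (norm_nonneg _)]
    refine ContinuousLinearMap.opNorm_le_bound _ (Real.sqrt_nonneg _) fun ξ => ?_
    have h := norm_sq_le_of_inner (inner_star T ξ (T.1 ξ))
    have h2 : ‖(star T).1 (T.1 ξ)‖ ≤ ‖star T * T‖ * ‖ξ‖ := (star T * T).1.le_opNorm ξ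
    refine (sq_le_sq₀ (norm_nonneg _) (by positivity)).1 ?_
    rw [mul_pow, Real.sq_sqrt (norm_nonneg _)]
    calc ‖T.1 ξ‖ ^ 2 ≤ ‖(star T).1 (T.1 ξ)‖ * ‖ξ‖ := h
      _ ≤ ‖star T * T‖ * ‖ξ‖ * ‖ξ‖ := by gcongr
      _ = _ := by ring

lemma continuous_inner_right (ζ : L2 G) :
    Continuous fun ξ : L2 G => inner C₀(UnitSpace G, ℂ) ζ ξ := by
  refine LipschitzWith.continuous (K := ‖ζ‖₊) (LipschitzWith.of_dist_le_mul ?_)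
  intro ξ η
  rw [dist_eq_norm, dist_eq_norm, ← ip_sub_right]
  refine (BoundedContinuousFunction.norm_le (by positivity)).2 fun x => ?_
  refine (norm_inner_le_norm (𝕜 := ℂ) (ζ.1.app x) ((ξ - η).1.app x)).trans ?_
  have h1 : ‖ζ.1.app x‖ ≤ ‖ζ‖ := ζ.1.norm_app_le x
  have h2 : ‖(ξ - η).1.app x‖ ≤ ‖ξ - η‖ := (ξ - η).1.norm_app_le x
  rw [coe_nnnorm]
  gcongr

instance : CompleteSpace (adjSubalgebra G) := by
  refine Metric.complete_of_cauchySeq_tendsto (α := adjSubalgebra G) fun u hu => ?_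
  have hval : UniformContinuous fun T : adjSubalgebra G => T.1 := uniformContinuous_subtype_val
  obtain ⟨T, hT⟩ := cauchySeq_tendsto_of_complete (hval.comp_cauchySeq hu)
  have hst : UniformContinuous fun T : adjSubalgebra G => star T :=
    (star_isometry (E := adjSubalgebra G)).uniformContinuous
  obtain ⟨S, hS⟩ := cauchySeq_tendsto_of_complete
    (hval.comp_cauchySeq (hst.comp_cauchySeq hu))
  have hadj : IsAdjointable T := by
    refine ⟨S, fun ξ η => ?_⟩
    have h1 : Tendsto (fun n => inner C₀(UnitSpace G, ℂ) η ((u n).1 ξ)) atTop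
        (𝓝 (inner C₀(UnitSpace G, ℂ) η (T ξ))) :=
      ((continuous_inner_right η).tendsto _).comp
        (((ContinuousLinearMap.apply ℂ (L2 G) ξ).continuous.tendsto T).comp hT)
    have h2 : Tendsto (fun n => star (inner C₀(UnitSpace G, ℂ) ξ ((star (u n)).1 η))) atTop
        (𝓝 (star (inner C₀(UnitSpace G, ℂ) ξ (S η)))) :=
      (((continuous_inner_right ξ).tendsto _).comp
        (((ContinuousLinearMap.apply ℂ (L2 G) η).continuous.tendsto S).comp hS)).star
    rw [ip_star] at h2
    refine tendsto_nhds_unique h1 (h2.congr fun n => ?_)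
    rw [ip_star, inner_star]
  exact ⟨⟨T, hadj⟩, tendsto_subtype_rng.2 hT⟩

instance instCStarAlgebraAdjSubalgebra : CStarAlgebra (adjSubalgebra G) where

variable (G) in
/-- The C⋆-algebra `𝓛(L²(G))` of adjointable operators on `L²(G)`, with the operator norm and the
adjoint `⟨η, Tξ⟩ = ⟨T*η, ξ⟩` as involution. -/
def AdjOps : Type _ := adjSubalgebra G

instance : NormedRing (AdjOps G) := inferInstanceAs (NormedRing (adjSubalgebra G))
instance : NormedAlgebra ℂ (AdjOps G) := inferInstanceAs (NormedAlgebra ℂ (adjSubalgebra G))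
instance : StarRing (AdjOps G) := inferInstanceAs (StarRing (adjSubalgebra G))
instance : StarModule ℂ (AdjOps G) := inferInstanceAs (StarModule ℂ (adjSubalgebra G))
instance : CStarRing (AdjOps G) := inferInstanceAs (CStarRing (adjSubalgebra G))
instance : CompleteSpace (AdjOps G) := inferInstanceAs (CompleteSpace (adjSubalgebra G))
instance : CStarAlgebra (AdjOps G) where

namespace AdjOps

/-- The bounded operator underlying an element of `𝓛(L²(G))`. -/
def toCLM (T : AdjOps G) : L2 G →L[ℂ] L2 G := T.1

/-- An adjointable bounded operator as an element of `𝓛(L²(G))`. -/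
def mk (T : L2 G →L[ℂ] L2 G) (hT : IsAdjointable T) : AdjOps G := ⟨T, hT⟩

@[simp] lemma toCLM_mk (T : L2 G →L[ℂ] L2 G) (hT : IsAdjointable T) : (mk T hT).toCLM = T := rfl

lemma isAdjointable (T : AdjOps G) : IsAdjointable T.toCLM := T.2

@[ext] lemma ext {S T : AdjOps G} (h : ∀ ξ, S.toCLM ξ = T.toCLM ξ) : S = T :=
  Subtype.ext (ContinuousLinearMap.ext h)

lemma norm_toCLM (T : AdjOps G) : ‖T.toCLM‖ = ‖T‖ := rfl

lemma inner_toCLM (T : AdjOps G) (ξ η : L2 G) : inner C₀(UnitSpace G, ℂ) η (T.toCLM ξ) =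
    inner C₀(UnitSpace G, ℂ) ((star T).toCLM η) ξ := inner_star T ξ η

lemma add_toCLM (S T : AdjOps G) : (S + T).toCLM = S.toCLM + T.toCLM := rfl
lemma smul_toCLM (c : ℂ) (T : AdjOps G) : (c • T).toCLM = c • T.toCLM := rfl
lemma mul_toCLM (S T : AdjOps G) : (S * T).toCLM = S.toCLM ∘L T.toCLM := rfl
lemma one_toCLM : (1 : AdjOps G).toCLM = ContinuousLinearMap.id ℂ (L2 G) := rfl
lemma zero_toCLM : (0 : AdjOps G).toCLM = 0 := rfl

end AdjOps

lemma diag_lam_slice (f g : Cc G) : diag (lamHom G f) (slice G g) = slice G (f * g) := by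
  refine ProdL2.ext fun x => lp.ext (funext fun γ => ?_)
  obtain ⟨γ, rfl⟩ := γ
  rfl

/-- The operator `Λ(f)` on `L²(G)`, given by `(Λ(f)ξ)|_{G_x} = λ_x(f)(ξ|_{G_x})`. -/
def leftOp (f : Cc G) : L2 G →L[ℂ] L2 G :=
  restrictL2 (diag (lamHom G f)) fun g => by rw [diag_lam_slice]; exact slice_mem _

/-- `(Λ(f)ξ)(γ) = ∑_{α ∈ G_{s(γ)}} f(γα⁻¹) ξ(α)`. -/
lemma leftOp_val (f : Cc G) (ξ : L2 G) (γ : G) :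
    L2val (leftOp f ξ) γ = ∑' α : Fib (src γ), f (γ * α.1⁻¹) * L2val ξ α.1 :=
  tsum_congr fun α => congrArg (f (γ * α.1⁻¹) * ·) (L2_app_apply ξ _ α)

lemma inner_leftOp (f : Cc G) (ξ η : L2 G) : inner C₀(UnitSpace G, ℂ) η (leftOp f ξ) =
    inner C₀(UnitSpace G, ℂ) (leftOp (star f) η) ξ := by
  ext x
  change inner ℂ (η.1.app x) (lam f x (ξ.1.app x)) = inner ℂ (lam (star f) x (η.1.app x)) (ξ.1.app x)
  rw [lam_star, ContinuousLinearMap.star_eq_adjoint, ContinuousLinearMap.adjoint_inner_left]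

variable (G) in
/-- The left regular representation `Λ : C_c(G) → 𝓛(L²(G))`. -/
def leftReg : Cc G →⋆ₙₐ[ℂ] AdjOps G where
  toFun f := AdjOps.mk (leftOp f) ⟨leftOp (star f), inner_leftOp f⟩
  map_smul' c f := AdjOps.ext fun ξ => Subtype.ext <|
    ProdL2.ext fun x => DFunLike.congr_fun (lam_smul c f x) (ξ.1.app x)
  map_zero' := AdjOps.ext fun ξ => Subtype.ext <|
    ProdL2.ext fun x => by
      have h : lam (0 : Cc G) x = 0 := congrArg (fun T => ProdB.app T x) (map_zero (lamHom G))
      exact DFunLike.congr_fun h (ξ.1.app x)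
  map_add' f g := AdjOps.ext fun ξ => Subtype.ext <|
    ProdL2.ext fun x => DFunLike.congr_fun (lam_add f g x) (ξ.1.app x)
  map_mul' f g := AdjOps.ext fun ξ => Subtype.ext <|
    ProdL2.ext fun x => DFunLike.congr_fun (lam_mul f g x) (ξ.1.app x)
  map_star' f := eq_star fun ξ η => by
    have h := inner_leftOp (star f) ξ η
    rwa [star_star] at h

lemma leftReg_val (f : Cc G) (ξ : L2 G) (γ : G) :
    L2val ((leftReg G f).toCLM ξ) γ = ∑' α : Fib (src γ), f (γ * α.1⁻¹) * L2val ξ α.1 :=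
  leftOp_val f ξ γ

end Adjointable

section Support

variable {G : Type*} [TopologicalSpace G] [EtaleGroupoid G]

lemma mulFib_bound (g : G →ᵇ ℂ) {x : UnitSpace G} (ξ : L2Fib x) (s : Finset (Fib x)) :
    ∑ γ ∈ s, ‖g γ.1 * ξ γ‖ ^ 2 ≤ (‖g‖ * ‖ξ‖) ^ 2 := by
  have hle : ∀ γ : Fib x, ‖g γ.1 * ξ γ‖ ≤ ‖g‖ * ‖ξ γ‖ := fun γ => by
    rw [norm_mul]
    exact mul_le_mul_of_nonneg_right (g.norm_coe_le_norm _) (norm_nonneg _)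
  have h1 := lp.sum_rpow_le_norm_rpow (p := 2) (by norm_num) ξ s
  have h2 : ∑ γ ∈ s, ‖ξ γ‖ ^ 2 ≤ ‖ξ‖ ^ 2 := by simpa using h1
  calc ∑ γ ∈ s, ‖g γ.1 * ξ γ‖ ^ 2 ≤ ∑ γ ∈ s, (‖g‖ * ‖ξ γ‖) ^ 2 :=
        Finset.sum_le_sum fun γ _ => pow_le_pow_left₀ (norm_nonneg _) (hle γ) 2
    _ = ‖g‖ ^ 2 * ∑ γ ∈ s, ‖ξ γ‖ ^ 2 := by simp only [mul_pow, Finset.mul_sum]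
    _ ≤ ‖g‖ ^ 2 * ‖ξ‖ ^ 2 := by gcongr
    _ = _ := by ring

lemma mulFib_memℓp (g : G →ᵇ ℂ) {x : UnitSpace G} (ξ : L2Fib x) :
    Memℓp (fun γ : Fib x => g γ.1 * ξ γ) 2 :=
  memℓp_gen' (C := (‖g‖ * ‖ξ‖) ^ 2) fun s => by simpa using mulFib_bound g ξ s

lemma norm_mulFib_aux (g : G →ᵇ ℂ) {x : UnitSpace G} (ξ : L2Fib x) :
    ‖(⟨fun γ : Fib x => g γ.1 * ξ γ, mulFib_memℓp g ξ⟩ : L2Fib x)‖ ≤ ‖g‖ * ‖ξ‖ :=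
  lp.norm_le_of_forall_sum_le (by norm_num) (by positivity)
    fun s => by simpa using mulFib_bound g ξ s

/-- Multiplication by `g ∈ C_b(G)` on `ℓ²(G_x)`. -/
def mulFib (g : G →ᵇ ℂ) (x : UnitSpace G) : L2Fib x →L[ℂ] L2Fib x :=
  LinearMap.mkContinuous
    { toFun := fun ξ => ⟨fun γ => g γ.1 * ξ γ, mulFib_memℓp g ξ⟩
      map_add' := fun ξ η => lp.ext (funext fun γ => mul_add (g γ.1) (ξ γ) (η γ))
      map_smul' := fun c ξ => lp.ext (funext fun γ => mul_left_comm (g γ.1) c (ξ γ)) }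
    ‖g‖ (norm_mulFib_aux g)

lemma mulFib_apply (g : G →ᵇ ℂ) (x : UnitSpace G) (ξ : L2Fib x) (γ : Fib x) :
    mulFib g x ξ γ = g γ.1 * ξ γ := rfl

lemma norm_mulFib_le (g : G →ᵇ ℂ) (x : UnitSpace G) : ‖mulFib g x‖ ≤ ‖g‖ :=
  LinearMap.mkContinuous_norm_le _ (norm_nonneg _) (norm_mulFib_aux g)

/-- The family `(g|_{G_x})_x` of multiplication operators. -/
def mulProd (g : G →ᵇ ℂ) : ProdB G :=
  (⟨mulFib g, memℓp_infty ⟨‖g‖, by rintro _ ⟨x, rfl⟩; exact norm_mulFib_le g x⟩⟩ :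
    lp (fun x : UnitSpace G => L2Fib x →L[ℂ] L2Fib x) ∞)

/-- The multiplication operator `M(g)` on `L²(G)`, for `g ∈ C_b(G)`. -/
def mulOp (g : G →ᵇ ℂ) : L2 G →L[ℂ] L2 G :=
  restrictL2 (diag (mulProd g)) fun f =>
    slice_mem (Cc.mk (fun γ => g γ * f γ) (g.continuous.mul f.continuous)
      (HasCompactSupport.mul_left f.hasCompactSupport'))

/-- `(M(g)ξ)(γ) = g(γ) ξ(γ)`. -/
lemma mulOp_val (g : G →ᵇ ℂ) (ξ : L2 G) (γ : G) : L2val (mulOp g ξ) γ = g γ * L2val ξ γ := rfl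

/-- The product `A · B = {αβ : α ∈ A, β ∈ B, s(α) = r(β)}` of sets of arrows. -/
def setMul (A B : Set G) : Set G := {γ | ∃ α ∈ A, ∃ β ∈ B, src α = rng β ∧ γ = α * β}

/-- `f` and `g` are `K`-separated: `(K · supp f) ∩ supp g = ∅` and `supp f ∩ (K · supp g) = ∅`. -/
def Separated (K : Set G) (f g : G →ᵇ ℂ) : Prop :=
  setMul K (tsupport f) ∩ tsupport g = ∅ ∧ tsupport f ∩ setMul K (tsupport g) = ∅

variable [T2Space G]

/-- `T` is supported in `K` if `g T f = 0` for all `K`-separated `f, g ∈ C_b(G)`. -/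
def IsSupportedIn (T : AdjOps G) (K : Set G) : Prop :=
  ∀ f g : G →ᵇ ℂ, Separated K f g → mulOp g ∘L T.toCLM ∘L mulOp f = 0

/-- `T` is compactly supported if it is supported in some compact subset of `G`. -/
def IsCompactlySupported (T : AdjOps G) : Prop := ∃ K : Set G, IsCompact K ∧ IsSupportedIn T K

end Support

section Equivariance

variable {G : Type*} [TopologicalSpace G] [EtaleGroupoid G]

lemma translate_memℓp {x : UnitSpace G} (β : Fib x) (η : L2Fib (rng β.1)) :
    Memℓp (fun γ : Fib x => η (rdiv β γ)) 2 :=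
  memℓp_gen ((rdiv β).summable_iff.2 ((lp.memℓp η).summable (by norm_num)))

lemma norm_translate_aux {x : UnitSpace G} (β : Fib x) (η : L2Fib (rng β.1)) :
    ‖(⟨fun γ : Fib x => η (rdiv β γ), translate_memℓp β η⟩ : L2Fib x)‖ = ‖η‖ := by
  rw [lp.norm_eq_tsum_rpow (by norm_num), lp.norm_eq_tsum_rpow (by norm_num)]
  congr 1
  exact (rdiv β).tsum_eq fun γ => ‖η γ‖ ^ (2 : ℝ≥0∞).toReal

/-- For `β ∈ G_x`, the isometry `ℓ²(G_{r(β)}) → ℓ²(G_x)`, `η ↦ (γ ↦ η(γβ⁻¹))`. -/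
def translate {x : UnitSpace G} (β : Fib x) : L2Fib (rng β.1) →ₗᵢ[ℂ] L2Fib x where
  toFun η := ⟨fun γ => η (rdiv β γ), translate_memℓp β η⟩
  map_add' _ _ := lp.ext (funext fun _ => rfl)
  map_smul' _ _ := lp.ext (funext fun _ => rfl)
  norm_map' η := norm_translate_aux β η

lemma translate_apply {x : UnitSpace G} (β γ : Fib x) (η : L2Fib (rng β.1)) :
    translate β η γ = η (rdiv β γ) := rfl

/-- For `g ∈ C_c(G)` and `x ∈ G⁰`, the map `ξ ↦ ∑_{β ∈ G_x} g(β) (γ ↦ ξ(γβ⁻¹))` with values in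
`ℓ²(G_x)`; the sum has only finitely many non-zero terms. -/
def rhoFib (g : Cc G) (x : UnitSpace G) (ξ : ProdL2 G) : L2Fib x :=
  ∑ β ∈ (finite_fib g.isCompact x).toFinset, g β.1 • translate β (ξ.app (rng β.1))

lemma rhoFib_apply (g : Cc G) (x : UnitSpace G) (ξ : ProdL2 G) (γ : Fib x) :
    rhoFib g x ξ γ = ∑' β : Fib x, g β.1 * ξ.app (rng β.1) (rdiv β γ) := by
  rw [tsum_eq_sum (s := (finite_fib g.isCompact x).toFinset), rhoFib, lp.coeFn_sum,
    Finset.sum_apply]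
  · rfl
  · intro β hβ
    have : β.1 ∉ tsupport g := by simpa using hβ
    rw [Cc.eq_zero_of_notMem this, zero_mul]

lemma exists_norm_rhoFib_le (g : Cc G) : ∃ C : ℝ, 0 ≤ C ∧ ∀ (ξ : ProdL2 G) (x : UnitSpace G),
    ‖rhoFib g x ξ‖ ≤ C * ‖ξ‖ := by
  obtain ⟨N, hN⟩ := exists_card_le g.isCompact
  obtain ⟨M, hM0, hM⟩ := g.exists_norm_le
  refine ⟨N * M, by positivity, fun ξ x => ?_⟩
  refine (norm_sum_le_of_le (f := fun β : Fib x => g β.1 • translate β (ξ.app (rng β.1)))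
    (n := fun _ => M * ‖ξ‖) _ fun β _ => ?_).trans ?_
  · rw [norm_smul, LinearIsometry.norm_map]
    exact mul_le_mul (hM _) (ξ.norm_app_le _) (norm_nonneg _) hM0
  · rw [Finset.sum_const, nsmul_eq_mul, mul_assoc]
    have : ((finite_fib g.isCompact x).toFinset.card : ℝ) ≤ N := by
      exact_mod_cast hN x _ fun γ hγ => by simpa using hγ
    gcongr

/-- Right convolution by `g ∈ C_c(G)` on `∏_x ℓ²(G_x)`. -/
def rhoProd (g : Cc G) : ProdL2 G →L[ℂ] ProdL2 G :=
  LinearMap.mkContinuousOfExistsBound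
    { toFun := fun ξ => ProdL2.mk (fun x => rhoFib g x ξ)
        ((exists_norm_rhoFib_le g).choose * ‖ξ‖) ((exists_norm_rhoFib_le g).choose_spec.2 ξ)
      map_add' := fun ξ η => ProdL2.ext fun x => by
        change rhoFib g x (ξ + η) = rhoFib g x ξ + rhoFib g x η
        simp only [rhoFib, ProdL2.add_app, map_add, smul_add, Finset.sum_add_distrib]
      map_smul' := fun c ξ => ProdL2.ext fun x => by
        change rhoFib g x (c • ξ) = c • rhoFib g x ξ
        simp only [rhoFib, ProdL2.smul_app, map_smul, Finset.smul_sum, smul_comm c] }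
    (by
      obtain ⟨C, hC0, hC⟩ := exists_norm_rhoFib_le g
      exact ⟨C, fun ξ => ProdL2.norm_le (by positivity) (hC ξ)⟩)

variable [T2Space G]

lemma rhoProd_slice (g f : Cc G) : rhoProd g (slice G f) = slice G (f * g) := by
  refine ProdL2.ext fun x => lp.ext (funext fun γ => ?_)
  obtain ⟨γ, rfl⟩ := γ
  change rhoFib g _ (slice G f) _ = (f * g) γ
  rw [rhoFib_apply, Cc.mul_apply]
  exact tsum_congr fun β => mul_comm _ _

/-- The right convolution operator `ρ(g)` on `L²(G)`: the bounded linear operator which on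
`C_c(G)` is `ξ ↦ ξ * g`. -/
def rho (g : Cc G) : L2 G →L[ℂ] L2 G :=
  restrictL2 (rhoProd g) fun f => by rw [rhoProd_slice]; exact slice_mem _

lemma rho_toL2 (g f : Cc G) : rho g (toL2 G f) = toL2 G (f * g) :=
  Subtype.ext (rhoProd_slice g f)

/-- `(ρ(g)ξ)(γ) = ∑_{β ∈ G_{s(γ)}} g(β) ξ(γβ⁻¹)`. -/
lemma rho_val (g : Cc G) (ξ : L2 G) (γ : G) :
    L2val (rho g ξ) γ = ∑' β : Fib (src γ), g β.1 * L2val ξ (γ * β.1⁻¹) := by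
  change rhoFib g _ ξ.1 _ = _
  rw [rhoFib_apply]
  exact tsum_congr fun β => congrArg (g β.1 * ·) (L2_app_apply ξ _ _)

/-- `T ∈ 𝓛(L²(G))` is `G`-equivariant if it commutes with `ρ(g)` for all `g ∈ C_c(G)`. -/
def IsEquivariant (T : AdjOps G) : Prop := ∀ g : Cc G, T.toCLM ∘L rho g = rho g ∘L T.toCLM

end Equivariance

variable (G : Type*) [TopologicalSpace G] [EtaleGroupoid G] [T2Space G]

/-- `ℂ_u[G]^G`: the set of compactly supported `G`-equivariant operators in `𝓛(L²(G))`. -/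
def equivariantRoe : Set (AdjOps G) := {T | IsCompactlySupported T ∧ IsEquivariant T}

end EtaleGroupoid

end

/-! An operator that commutes with all right convolutions ought to be left convolution by its value
at a unit of the algebra. `C_c(G)` need not have a unit, but it has local ones: since `r` is a local
homeomorphism, `G⁰` is open in `G` (`isOpen_units`), so a function in `C_c(G⁰)` extended by zero
lies in `C_c(G)`. Right convolution by such a `χ` is multiplication by `χ ∘ s` (`rho_val_of_units`).
Commuting `T` past these operators gives `Tχ = (χ ∘ s) · k` for one continuous function `k` on `G`,
the same for all `χ` (`IsEquivariant.exists_kernel`). If `T` is supported in a compact `K`, then `k`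
vanishes off `K ∪ K⁻¹` (`kernel_eq_zero`), so `k ∈ C_c(G)`. Finally any `ξ ∈ C_c(G)` equals `χ * ξ`
once `χ = 1` on `r(supp ξ)`, whence `Tξ = T(ρ(ξ)χ) = (Tχ) * ξ = k * ξ` and `T = Λ(k)`
(`exists_leftReg_eq`).

Conversely, `Λ(f)` is equivariant by associativity and is supported in `supp f`. Thus the compactly
supported equivariant operators are exactly the range of a ⋆-homomorphism, which makes them a
⋆-subalgebra with no direct study of supports of products or adjoints.

For the second claim it suffices that `‖Λ(f)‖ = sup_x ‖λ_x(f)‖` (`norm_leftReg`). The bound `≤` is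
fibrewise. For `≥`, a vector of `L²(G)` can be damped by a function of the source so that its norm
is attained on a chosen fibre without changing it there (`exists_app_eq_norm_le`), and restrictions
of `C_c(G)` are dense in `ℓ²(G_x)`. Two ⋆-homomorphisms inducing the same norm have isometrically
isomorphic range closures (`exists_closureRange_equiv`). Injectivity of `Λ` also follows, since `f ↦
(λ_x(f))_x` is injective. -/

namespace EtaleGroupoid

open ArrowGroupoid

/-! ### Units as arrows. -/

section Units

variable {G : Type*} [ArrowGroupoid G]

lemma inv_unit (x : UnitSpace G) : (x : G)⁻¹ = (x : G) := by
  have h2 := inv_mul_eq (x : G)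
  rw [src_unit] at h2
  have h3 := mul_src ((x : G)⁻¹)
  rw [src_inv, rng_unit, h2] at h3
  exact h3.symm

lemma mul_inv_src (γ : G) : γ * (src γ : G)⁻¹ = γ := by
  rw [inv_unit, mul_src]

lemma coe_src_of_mem_units {γ : G} (h : γ ∈ (units : Set G)) : (src γ : G) = γ :=
  congrArg Subtype.val (src_unit ⟨γ, h⟩)

lemma Fib.eq_unit {x : UnitSpace G} {β : Fib x} (h : β.1 ∈ (units : Set G)) : β = Fib.unit x :=
  Subtype.ext ((coe_src_of_mem_units h).symm.trans (congrArg Subtype.val β.2))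

end Units

/-! ### Bump functions, openness of the unit space, and continuity of elements of `L²(G)`. -/

/-- An element of `C_c(G)` as a bounded continuous function. -/
noncomputable def Cc.toBCF {G : Type*} [TopologicalSpace G] (f : Cc G) : G →ᵇ ℂ :=
  BoundedContinuousFunction.ofNormedAddCommGroup f f.continuous f.exists_norm_le.choose
    f.exists_norm_le.choose_spec.2

lemma Cc.toBCF_apply {G : Type*} [TopologicalSpace G] (f : Cc G) (γ : G) : f.toBCF γ = f γ := rfl

/-- Urysohn's lemma for `C_c(G)`. -/
lemma Cc.exists_eq_one {G : Type*} [TopologicalSpace G] [LocallyCompactSpace G] [T2Space G] {L V : Set G} (hL : IsCompact L)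
    (hV : IsOpen V) (hLV : L ⊆ V) :
    ∃ χ : Cc G, (∀ γ ∈ L, χ γ = 1) ∧ tsupport χ ⊆ V := by
  obtain ⟨f, h1, hc, hs, -⟩ := exists_continuousMap_one_of_isCompact_subset_isOpen hL hV hLV
  have hsub : tsupport (fun γ => (f γ : ℂ)) ⊆ tsupport f :=
    closure_mono fun γ hγ h => hγ (by simp [h])
  exact ⟨Cc.mk (fun γ => (f γ : ℂ)) (Complex.continuous_ofReal.comp f.continuous)
    (hc.of_isClosed_subset (isClosed_tsupport _) hsub),
    fun γ hγ => (congrArg Complex.ofReal (h1 hγ)).trans Complex.ofReal_one, hsub.trans hs⟩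

variable {G : Type*} [TopologicalSpace G] [EtaleGroupoid G]

/-- Near a unit `x` the map `r` is injective. For `γ` close to `x`, the unit `r(γ)` is also close to
`r(x) = x`, and `γ` and `r(γ)` have the same range, so they coincide. -/
lemma isOpen_units : IsOpen (units : Set G) := by
  rw [isOpen_iff_mem_nhds]
  intro x hx
  obtain ⟨e, hxe, he⟩ := isLocalHomeomorph_rng x
  have hrx : ((rng x : UnitSpace G) : G) = x := congrArg Subtype.val (rng_unit ⟨x, hx⟩)
  have hc : ContinuousAt (fun γ : G => ((rng γ : UnitSpace G) : G)) x :=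
    (continuous_subtype_val.comp continuous_rng).continuousAt
  have h1 : ∀ᶠ γ in 𝓝 x, ((rng γ : UnitSpace G) : G) ∈ e.source :=
    hc (by change _ ∈ 𝓝 ((rng x : UnitSpace G) : G); rw [hrx]; exact e.open_source.mem_nhds hxe)
  filter_upwards [h1, e.open_source.mem_nhds hxe] with γ h2 h3
  have h4 : γ = ((rng γ : UnitSpace G) : G) := by
    refine e.injOn h3 h2 ?_
    rw [← he, rng_unit]
  rw [h4]
  exact (rng γ).2

lemma norm_L2val_le (ξ : L2 G) (γ : G) : ‖L2val ξ γ‖ ≤ ‖ξ‖ :=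
  (lp.norm_apply_le_norm (by norm_num) _ _).trans (ξ.1.norm_app_le _)

/-- The module norm dominates the supremum norm, so every element is a uniform limit of functions in
`C_c(G)`. This is what makes the kernel of an operator continuous. -/
lemma continuous_L2val (ξ : L2 G) : Continuous (L2val ξ) := by
  refine continuous_of_uniform_approx_of_continuous fun u hu => ?_
  obtain ⟨ε, hε, hu⟩ := Metric.mem_uniformity_dist.1 hu
  obtain ⟨f, hf⟩ := exists_slice_near ξ.2 hε
  refine ⟨f, f.continuous, fun γ => hu ?_⟩
  rw [dist_eq_norm]
  exact (norm_L2val_le (ξ - toL2 G f) γ).trans_lt hf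

lemma denseRange_toL2 : DenseRange (toL2 G) := by
  intro ξ
  refine Metric.mem_closure_iff.2 fun ε hε => ?_
  obtain ⟨f, hf⟩ := exists_slice_near ξ.2 hε
  exact ⟨_, ⟨f, rfl⟩, by rw [dist_eq_norm]; exact hf⟩

/-- Bounded operators on `L²(G)` are determined by their values on `C_c(G)`. -/
lemma L2_clm_ext {S T : L2 G →L[ℂ] L2 G} (h : ∀ f, S (toL2 G f) = T (toL2 G f)) : S = T :=
  ContinuousLinearMap.ext fun ξ => congrFun
    (denseRange_toL2.equalizer S.continuous T.continuous (funext h)) ξ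

variable [T2Space G]

/-! ### Left convolution operators are equivariant and compactly supported. -/

lemma leftReg_toL2 (f g : Cc G) : (leftReg G f).toCLM (toL2 G g) = toL2 G (f * g) :=
  L2_ext fun γ => leftReg_val f (toL2 G g) γ

/-- On the dense subspace `C_c(G)` this is `f * (h * g) = (f * h) * g`. -/
lemma isEquivariant_leftReg (f : Cc G) : IsEquivariant (leftReg G f) := fun g =>
  L2_clm_ext fun h => by
    simp only [ContinuousLinearMap.comp_apply, rho_toL2, leftReg_toL2, mul_assoc]

/-- A non-zero term `g(γ) f(γα⁻¹) h(α)` exhibits `γ = (γα⁻¹)α` as a point of `supp f · supp h` lying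
in `supp g`. Only the first of the two separation conditions is needed. -/
lemma isSupportedIn_leftReg (f : Cc G) : IsSupportedIn (leftReg G f) (tsupport f) := by
  refine fun h g hsep => ContinuousLinearMap.ext fun ξ => L2_ext fun γ => ?_
  change L2val (mulOp g ((leftReg G f).toCLM (mulOp h ξ))) γ = 0
  rw [mulOp_val, leftReg_val, mul_eq_zero, or_iff_not_imp_left]
  intro hg
  refine (tsum_congr fun α => ?_).trans tsum_zero
  rw [mulOp_val]
  by_contra hne
  have h1 : f (γ * α.1⁻¹) ≠ 0 := left_ne_zero_of_mul hne
  have h2 : h α.1 ≠ 0 := left_ne_zero_of_mul (right_ne_zero_of_mul hne)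
  refine Set.eq_empty_iff_forall_notMem.1 hsep.1 γ ⟨⟨γ * α.1⁻¹, Cc.mem_of_ne h1, α.1,
    subset_tsupport _ h2, src_div α.2.symm, (div_mul_self α.2.symm).symm⟩, subset_tsupport _ hg⟩

lemma leftReg_mem_equivariantRoe (f : Cc G) : leftReg G f ∈ equivariantRoe G :=
  ⟨⟨_, f.isCompact, isSupportedIn_leftReg f⟩, isEquivariant_leftReg f⟩

/-! ### An equivariant compactly supported operator is convolution by its kernel. -/

/-- Right convolution by a function supported in the unit space is multiplication by that
function composed with the source map. -/
lemma rho_val_of_units {χ : Cc G} (hχ : tsupport χ ⊆ units) (ξ : L2 G) (γ : G) :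
    L2val (rho χ ξ) γ = χ (src γ : G) * L2val ξ γ := by
  -- A source fibre contains exactly one unit, so the convolution sum has a single term.
  rw [rho_val, tsum_eq_single (Fib.unit (src γ))]
  · change χ (src γ : G) * L2val ξ (γ * (src γ : G)⁻¹) = _
    rw [mul_inv_src]
  · intro β hβ
    rw [Cc.eq_zero_of_notMem fun h => hβ (Fib.eq_unit (hχ h)), zero_mul]

/-- On functions supported in `G⁰`, convolution is the pointwise product. -/
lemma mul_comm_of_units {χ χ' : Cc G} (hχ : tsupport χ ⊆ units) (hχ' : tsupport χ' ⊆ units) :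
    χ * χ' = χ' * χ := by
  ext γ
  rw [← L2val_toL2, ← L2val_toL2, ← rho_toL2, ← rho_toL2, rho_val_of_units hχ',
    rho_val_of_units hχ, L2val_toL2, L2val_toL2]
  by_cases h : γ ∈ (units : Set G)
  · rw [coe_src_of_mem_units h, mul_comm]
  · rw [Cc.eq_zero_of_notMem fun h' => h (hχ h'), Cc.eq_zero_of_notMem fun h' => h (hχ' h')]
    simp

lemma IsEquivariant.apply_rho {T : AdjOps G} (hT : IsEquivariant T) (g : Cc G) (ξ : L2 G) :
    T.toCLM (rho g ξ) = rho g (T.toCLM ξ) := DFunLike.congr_fun (hT g) ξ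

/-- Both sides are values of `T(χ * χ') = T(χ' * χ)`, with `T` moved past the right factor. It says
that the ratio `Tχ / (χ ∘ s)` does not depend on `χ`; this ratio is the kernel. -/
lemma IsEquivariant.val_mul_comm {T : AdjOps G} (hT : IsEquivariant T) {χ χ' : Cc G}
    (hχ : tsupport χ ⊆ units) (hχ' : tsupport χ' ⊆ units) (γ : G) :
    χ' (src γ : G) * L2val (T.toCLM (toL2 G χ)) γ =
      χ (src γ : G) * L2val (T.toCLM (toL2 G χ')) γ := by
  rw [← rho_val_of_units hχ', ← rho_val_of_units hχ, ← hT.apply_rho, ← hT.apply_rho, rho_toL2,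
    rho_toL2, mul_comm_of_units hχ hχ']

variable [LocallyCompactSpace G]

/-- The convolution kernel of an equivariant operator. -/
lemma IsEquivariant.exists_kernel {T : AdjOps G} (hT : IsEquivariant T) :
    ∃ k : G → ℂ, Continuous k ∧ ∀ χ : Cc G, tsupport χ ⊆ units → ∀ γ,
      L2val (T.toCLM (toL2 G χ)) γ = χ (src γ : G) * k γ := by
  have h : ∀ x : UnitSpace G, ∃ χ : Cc G, χ (x : G) = 1 ∧ tsupport χ ⊆ units := fun x => by
    obtain ⟨χ, h1, h2⟩ := Cc.exists_eq_one (isCompact_singleton (x := (x : G))) isOpen_units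
      (Set.singleton_subset_iff.2 x.2)
    exact ⟨χ, h1 _ rfl, h2⟩
  choose e he heu using h
  -- The bump function `e x` is `1` at `x`, so comparing `χ` with `e (s(γ))` at `γ` needs no
  -- division.
  have hk : ∀ χ : Cc G, tsupport χ ⊆ units → ∀ γ, L2val (T.toCLM (toL2 G χ)) γ =
      χ (src γ : G) * L2val (T.toCLM (toL2 G (e (src γ)))) γ := fun χ hχ γ => by
    rw [← hT.val_mul_comm hχ (heu _), he, one_mul]
  refine ⟨fun γ => L2val (T.toCLM (toL2 G (e (src γ)))) γ, ?_, hk⟩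
  rw [continuous_iff_continuousAt]
  intro γ₀
  set χ := e (src γ₀) with hχ
  have hc : Continuous fun γ : G => χ (src γ : G) :=
    χ.continuous.comp (continuous_subtype_val.comp continuous_src)
  have h0 : χ (src γ₀ : G) ≠ 0 := by rw [hχ, he]; exact one_ne_zero
  -- The defining formula uses a bump function that varies with `γ` in no continuous way. Near `γ₀`
  -- the kernel is instead the quotient `Tχ / (χ ∘ s)` for the fixed bump `χ = e (s(γ₀))`.
  refine ((continuous_L2val (T.toCLM (toL2 G χ))).continuousAt.div hc.continuousAt h0).congr ?_
  filter_upwards [hc.continuousAt.eventually_ne h0] with γ hγ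
  change L2val (T.toCLM (toL2 G χ)) γ / χ (src γ : G) = _
  rw [hk χ (heu _) γ, mul_div_cancel_left₀ _ hγ]

/-- The support condition is tested on a bump `χ` around the unit `s(γ)` and a bump `g` around `γ`
that avoids `K ∪ K⁻¹`. The inverse set enters because compact support constrains only pairs
satisfying both separation conditions. -/
lemma kernel_eq_zero {T : AdjOps G} {K : Set G} (hK : IsCompact K) (hTK : IsSupportedIn T K)
    {k : G → ℂ} (hk : ∀ χ : Cc G, tsupport χ ⊆ units → ∀ γ,
      L2val (T.toCLM (toL2 G χ)) γ = χ (src γ : G) * k γ) {γ : G}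
    (h1 : γ ∉ K) (h2 : γ ∉ (fun a : G => a⁻¹) '' K) : k γ = 0 := by
  have hcl : IsClosed (K ∪ (fun a : G => a⁻¹) '' K) :=
    (hK.union (hK.image continuous_inv)).isClosed
  obtain ⟨g, hg1, hgs⟩ := Cc.exists_eq_one (isCompact_singleton (x := γ)) hcl.isOpen_compl
    (Set.singleton_subset_iff.2 fun h => h.elim h1 h2)
  obtain ⟨χ, hχ1, hχu⟩ := Cc.exists_eq_one (isCompact_singleton (x := (src γ : G))) isOpen_units
    (Set.singleton_subset_iff.2 (src γ).2)
  have hsep : Separated K χ.toBCF g.toBCF := by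
    constructor
    -- Multiplying by units on the right does not move `K`, so `K · supp χ ⊆ K`.
    · refine Set.eq_empty_iff_forall_notMem.2 ?_
      rintro _ ⟨⟨α, hα, β, hβ, hαβ, rfl⟩, hm⟩
      have hβu : β ∈ (units : Set G) := hχu hβ
      have : (src α : G) = β := by
        rw [hαβ]; exact congrArg Subtype.val (rng_unit ⟨β, hβu⟩)
      rw [← this, mul_src] at hm
      exact hgs hm (Or.inl hα)
    -- A product `αβ` that is a unit forces `β = α⁻¹ ∈ K⁻¹`, which `supp g` avoids.
    · refine Set.eq_empty_iff_forall_notMem.2 ?_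
      rintro _ ⟨hm, ⟨α, hα, β, hβ, hαβ, rfl⟩⟩
      have hu : α * β ∈ (units : Set G) := hχu hm
      have h3 : α * β = (src β : G) := by
        rw [← src_mul _ _ hαβ, coe_src_of_mem_units hu]
      have h4 : α = β⁻¹ := by
        rw [← mul_div_self hαβ, h3, ← rng_inv, rng_mul_self]
      refine hgs hβ (Or.inr ⟨α, hα, ?_⟩)
      change α⁻¹ = β
      rw [h4, inv_inv']
  -- The operator `g T χ` is applied to `χ` itself, so `T` acts on the pointwise square of `χ`. That
  -- is again supported in `G⁰` and equals `1` at `s(γ)`, so evaluation at `γ` leaves exactly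
  -- `k(γ)`.
  have h0 := congrArg (fun S : L2 G →L[ℂ] L2 G => L2val (S (toL2 G χ)) γ) (hTK _ _ hsep)
  let χ' : Cc G := Cc.mk (fun δ => χ δ * χ δ) (χ.continuous.mul χ.continuous)
    (HasCompactSupport.mul_left χ.hasCompactSupport')
  have hχ' : mulOp χ.toBCF (toL2 G χ) = toL2 G χ' := L2_ext fun δ => rfl
  have hχ'u : tsupport χ' ⊆ units := (closure_mono fun δ hδ => left_ne_zero_of_mul hδ).trans hχu
  change L2val (mulOp g.toBCF (T.toCLM (mulOp χ.toBCF (toL2 G χ)))) γ = 0 at h0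
  rw [mulOp_val, hχ', hk χ' hχ'u, Cc.toBCF_apply, hg1 γ rfl] at h0
  have h5 : χ' (src γ : G) = 1 := by
    change χ _ * χ _ = 1
    rw [hχ1 _ rfl, one_mul]
  rwa [h5, one_mul, one_mul] at h0

/-- With `χ` a left unit for `ξ ∈ C_c(G)`, equivariance under `ρ(ξ)` reduces `Tξ` to `Tχ`, which the
kernel describes. The function `χ` depends on `ξ`, but the kernel does not. -/
lemma exists_leftReg_eq {T : AdjOps G} (hT : T ∈ equivariantRoe G) :
    ∃ f : Cc G, leftReg G f = T := by
  obtain ⟨⟨K, hK, hTK⟩, hT⟩ := hT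
  obtain ⟨k, hkc, hk⟩ := hT.exists_kernel
  let f : Cc G := Cc.mk k hkc (HasCompactSupport.intro (hK.union (hK.image continuous_inv))
    fun γ hγ => kernel_eq_zero hK hTK hk (fun h => hγ (Or.inl h)) fun h => hγ (Or.inr h))
  refine ⟨f, AdjOps.ext (DFunLike.congr_fun (L2_clm_ext fun ξ => ?_))⟩
  let R : Set G := (fun γ : G => (rng γ : G)) '' tsupport ξ
  have hR : IsCompact R := ξ.isCompact.image (continuous_subtype_val.comp continuous_rng)
  obtain ⟨χ, hχ1, hχu⟩ := Cc.exists_eq_one hR isOpen_units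
    (by rintro _ ⟨γ, -, rfl⟩; exact (rng γ).2)
  have hχR : ∀ β : G, ξ β ≠ 0 → χ (rng β : G) = 1 := fun β hβ =>
    hχ1 _ ⟨β, Cc.mem_of_ne hβ, rfl⟩
  have hχξ : χ * ξ = ξ := by
    ext γ
    rw [Cc.mul_apply, tsum_eq_single ⟨γ, rfl⟩]
    · change χ (γ * γ⁻¹) * ξ γ = ξ γ
      rw [mul_inv_eq]
      by_cases h : ξ γ = 0
      · rw [h, mul_zero]
      · rw [hχR γ h, one_mul]
    -- Off the diagonal term, `γα⁻¹ ∈ supp χ` would be a unit, forcing `α = γ`.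
    · intro α hα
      rw [Cc.eq_zero_of_notMem, zero_mul]
      intro h
      refine hα (Subtype.ext ?_)
      have h1 := rng_div α.2.symm
      have h2 := congrArg Subtype.val (rng_unit ⟨_, hχu h⟩)
      rw [h1] at h2
      have h3 := div_mul_self α.2.symm
      have h4 := src_div α.2.symm
      have h5 := coe_src_of_mem_units (hχu h)
      rw [← h5, h4, rng_mul_self] at h3
      exact h3
  rw [leftReg_toL2]
  -- `Tξ = T(χ * ξ) = T(ρ(ξ)χ) = ρ(ξ)(Tχ)`.
  conv_rhs => rw [← hχξ, ← rho_toL2, hT.apply_rho]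
  refine L2_ext fun γ => ?_
  rw [rho_val, L2val_toL2, Cc.mul_apply]
  refine tsum_congr fun β => ?_
  -- The factor from the kernel formula is `χ(s(γβ⁻¹)) = χ(r(β))`, which is `1` wherever `ξ(β) ≠ 0`.
  rw [hk χ hχu, src_div β.2.symm]
  change k _ * ξ β.1 = _
  by_cases h : ξ β.1 = 0
  · rw [h, zero_mul, mul_zero]
  · rw [hχR _ h, one_mul, mul_comm]

end EtaleGroupoid

/-! ### The left regular representation is isometric for the reduced norm. -/

namespace EtaleGroupoid

open ArrowGroupoid

variable {G : Type*} [TopologicalSpace G] [EtaleGroupoid G]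

/-- The restriction of functions in `C_c(G)` to a source fibre, as a linear map. -/
noncomputable def restrictHom (x : UnitSpace G) : Cc G →ₗ[ℂ] L2Fib x where
  toFun f := restrict f x
  map_add' _ _ := rfl
  map_smul' _ _ := rfl

/-- A bump at `α` supported where `s` is injective meets the fibre `G_x` only in `α`. -/
lemma exists_restrict_eq_delta [LocallyCompactSpace G] [T2Space G] {x : UnitSpace G}
    (α : Fib x) : ∃ φ : Cc G, restrict φ x = delta α := by
  obtain ⟨e, hα, he⟩ := isLocalHomeomorph_src α.1
  obtain ⟨φ, h1, hφ⟩ := Cc.exists_eq_one (isCompact_singleton (x := α.1)) e.open_source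
    (Set.singleton_subset_iff.2 hα)
  refine ⟨φ, lp.ext (funext fun γ => ?_)⟩
  rw [restrict_apply]
  by_cases h : γ = α
  · rw [h, delta_self, h1 _ rfl]
  · rw [delta_ne h]
    refine Cc.eq_zero_of_notMem fun hγ => h (Subtype.ext (e.injOn (hφ hγ) hα ?_))
    rw [← he, γ.2, α.2]

lemma denseRange_restrictHom [LocallyCompactSpace G] [T2Space G] (x : UnitSpace G) :
    DenseRange (restrictHom x) := by
  classical
  intro v
  refine mem_closure_of_tendsto (lp.hasSum_single (by norm_num) v) (Eventually.of_forall fun s => ?_)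
  change _ ∈ LinearMap.range (restrictHom x)
  refine Submodule.sum_mem _ fun α _ => ?_
  obtain ⟨φ, hφ⟩ := exists_restrict_eq_delta α
  refine ⟨v α • φ, ?_⟩
  rw [map_smul]
  change v α • restrict φ x = _
  rw [hφ, delta, ← lp.single_smul, smul_eq_mul, mul_one]

variable [T2Space G]

/-- `‖ξ_x‖²` is the value at `x` of `⟨ξ, ξ⟩ ∈ C₀(G⁰)`. Continuity makes the damping factor in
`exists_app_eq_norm_le` a legitimate multiplier. -/
lemma continuous_norm_app (ξ : L2 G) : Continuous fun x => ‖ξ.1.app x‖ := by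
  have h : (fun x => ‖ξ.1.app x‖) = fun x => √‖baseInner ξ ξ x‖ := funext fun x => by
    rw [baseInner_app, inner_self_eq_norm_sq_to_K, norm_pow, RCLike.norm_ofReal, abs_norm,
      Real.sqrt_sq (norm_nonneg _)]
  rw [h]
  exact ((baseInner ξ ξ).continuous.norm).sqrt

/-- Every element of `L²(G)` has the same restriction to a given fibre as an element whose norm is
attained on that fibre. -/
lemma exists_app_eq_norm_le (ξ : L2 G) (x : UnitSpace G) :
    ∃ η : L2 G, η.1.app x = ξ.1.app x ∧ ‖η‖ ≤ ‖ξ.1.app x‖ := by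
  set c := ‖ξ.1.app x‖ with hc
  rcases (norm_nonneg (ξ.1.app x)).eq_or_lt' with h0 | h0
  · exact ⟨0, (norm_eq_zero.1 h0).symm, by rw [norm_zero]; exact norm_nonneg _⟩
  have hm : ∀ y, 0 < max c ‖ξ.1.app y‖ := fun y => lt_max_of_lt_left h0
  -- The factor `c / max(c, ‖ξ_y‖)` is `1` at `y = x` and scales every fibre of norm above `c` down
  -- to norm `c`. The case `c = 0` was split off to keep the denominator positive.
  have hcont : Continuous fun γ : G => ((c / max c ‖ξ.1.app (src γ)‖ : ℝ) : ℂ) :=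
    Complex.continuous_ofReal.comp (continuous_const.div
      (continuous_const.max ((continuous_norm_app ξ).comp continuous_src)) fun γ => (hm _).ne')
  have hnorm : ∀ y, ‖((c / max c ‖ξ.1.app y‖ : ℝ) : ℂ)‖ = c / max c ‖ξ.1.app y‖ := fun y => by
    rw [Complex.norm_real, Real.norm_of_nonneg (div_nonneg h0.le (hm y).le)]
  let g : G →ᵇ ℂ := BoundedContinuousFunction.ofNormedAddCommGroup _ hcont 1 fun γ => by
    rw [hnorm]
    exact div_le_one_of_le₀ (le_max_left _ _) (hm _).le
  have happ : ∀ y, (mulOp g ξ).1.app y = ((c / max c ‖ξ.1.app y‖ : ℝ) : ℂ) • ξ.1.app y :=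
    fun y => lp.ext (funext fun γ => by
      change ((c / max c ‖ξ.1.app (src γ.1)‖ : ℝ) : ℂ) * ξ.1.app y γ =
        ((c / max c ‖ξ.1.app y‖ : ℝ) : ℂ) * ξ.1.app y γ
      rw [γ.2])
  refine ⟨mulOp g ξ, ?_, ProdL2.norm_le (ξ := (mulOp g ξ).1) h0.le fun y => ?_⟩
  · rw [happ, ← hc, max_self, div_self h0.ne', Complex.ofReal_one, one_smul]
  · rw [happ, norm_smul, hnorm, div_mul_eq_mul_div, div_le_iff₀ (hm y)]
    gcongr
    exact le_max_right _ _

lemma norm_leftReg_le (f : Cc G) : ‖leftReg G f‖ ≤ ‖lamHom G f‖ :=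
  ContinuousLinearMap.opNorm_le_bound (leftOp f) (norm_nonneg _) fun ξ =>
    ProdL2.norm_le (ξ := (leftOp f ξ).1) (by positivity) fun x =>
      ((lamHom G f).app x).le_of_opNorm_le_of_le ((lamHom G f).norm_app_le x) (ξ.1.norm_app_le x)

/-- The operator bound for `Λ(f)` involves the supremum of the fibre norms of the vector. Replacing
`ξ` by a vector with the same fibre at `x` and no larger norm elsewhere turns it into a bound on
that fibre alone. -/
lemma norm_lam_apply_le (f : Cc G) (ξ : L2 G) (x : UnitSpace G) :
    ‖lam f x (ξ.1.app x)‖ ≤ ‖leftReg G f‖ * ‖ξ.1.app x‖ := by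
  obtain ⟨η, hη, hle⟩ := exists_app_eq_norm_le ξ x
  rw [← hη] at hle ⊢
  have h1 : ‖lam f x (η.1.app x)‖ ≤ ‖(leftReg G f).toCLM η‖ :=
    ((leftReg G f).toCLM η).1.norm_app_le x
  refine (h1.trans ((leftReg G f).toCLM.le_opNorm η)).trans ?_
  rw [AdjOps.norm_toCLM]
  gcongr

variable [LocallyCompactSpace G]

/-- The left regular representation is isometric for the reduced norm. -/
lemma norm_leftReg (f : Cc G) : ‖leftReg G f‖ = ‖lamHom G f‖ := by
  refine (norm_leftReg_le f).antisymm (lp.norm_le_of_forall_le (norm_nonneg _) fun x => ?_)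
  refine ContinuousLinearMap.opNorm_le_bound _ (norm_nonneg _) fun v => ?_
  -- The bound is closed in `v` and holds for the dense set of restrictions of `C_c(G)`.
  exact (denseRange_restrictHom x).induction_on (p := fun v => ‖lam f x v‖ ≤ ‖leftReg G f‖ * ‖v‖) v
    (isClosed_le (lam f x).continuous.norm (continuous_const.mul continuous_norm))
    fun φ => norm_lam_apply_le f (toL2 G φ) x

lemma leftReg_injective : Function.Injective (leftReg G) :=
  (injective_iff_map_eq_zero _).2 fun f hf => by
    rw [← map_eq_zero_iff (lamHom G) lamHom_injective, ← norm_eq_zero, ← norm_leftReg, hf, norm_zero]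

end EtaleGroupoid

/-! ### Extending an isometric identification to closures of ranges. -/

section StarClosure

variable {A B C : Type*} [NonUnitalRing A] [StarRing A] [Module ℂ A]
  [NonUnitalCStarAlgebra B] [NonUnitalCStarAlgebra C]

lemma NonUnitalStarSubalgebra.continuousStar (S : NonUnitalStarSubalgebra ℂ B) :
    ContinuousStar S :=
  ⟨continuous_subtype_val.star.subtype_mk _⟩

/-- A ⋆-homomorphism into a C⋆-algebra, as a linear map into the closure of its range. -/
def NonUnitalStarAlgHom.toClosureRange (i : A →⋆ₙₐ[ℂ] B) :
    A →ₗ[ℂ] (NonUnitalStarAlgHom.range i).topologicalClosure where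
  toFun a := ⟨i a, NonUnitalStarSubalgebra.le_topologicalClosure _ ⟨a, rfl⟩⟩
  map_add' a b := Subtype.ext (map_add i a b)
  map_smul' c a := Subtype.ext (map_smul i c a)

lemma NonUnitalStarAlgHom.denseRange_toClosureRange (i : A →⋆ₙₐ[ℂ] B) :
    DenseRange i.toClosureRange := by
  rintro ⟨b, hb⟩
  rw [Metric.mem_closure_iff]
  intro ε hε
  obtain ⟨_, ⟨a, rfl⟩, h⟩ := Metric.mem_closure_iff.1 hb ε hε
  exact ⟨_, ⟨a, rfl⟩, h⟩

/-- Two ⋆-homomorphisms into C⋆-algebras that induce the same seminorm have isometrically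
isomorphic range closures. -/
lemma NonUnitalStarAlgHom.exists_closureRange_equiv (i : A →⋆ₙₐ[ℂ] B) (j : A →⋆ₙₐ[ℂ] C)
    (h : ∀ a, ‖i a‖ = ‖j a‖) :
    ∃ ψ : (NonUnitalStarAlgHom.range i).topologicalClosure ≃⋆ₐ[ℂ]
        (NonUnitalStarAlgHom.range j).topologicalClosure,
      Isometry ψ ∧ ∀ a, ψ (i.toClosureRange a) = j.toClosureRange a := by
  have hi := i.denseRange_toClosureRange
  have hj := j.denseRange_toClosureRange
  have : CompleteSpace (NonUnitalStarAlgHom.range i).topologicalClosure :=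
    (NonUnitalStarSubalgebra.isClosed_topologicalClosure _).completeSpace_coe
  have : CompleteSpace (NonUnitalStarAlgHom.range j).topologicalClosure :=
    (NonUnitalStarSubalgebra.isClosed_topologicalClosure _).completeSpace_coe
  have := (NonUnitalStarAlgHom.range i).topologicalClosure.continuousStar
  have := (NonUnitalStarAlgHom.range j).topologicalClosure.continuousStar
  -- `A` carries no topology of its own. The identity of `A` is extended from one dense image to the
  -- other, which is possible because both maps induce the same seminorm.
  let e := (LinearEquiv.refl ℂ A).extendOfIsometry i.toClosureRange j.toClosureRange hi hj
    fun a => (h a).symm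
  have he : ∀ a, e (i.toClosureRange a) = j.toClosureRange a :=
    LinearEquiv.extendOfIsometry_eq _ _ _ hi hj fun a => (h a).symm
  -- Multiplicativity, and likewise compatibility with the involution below, is a closed condition
  -- that holds on the dense image.
  have hmul : ∀ a b, e (a * b) = e a * e b := by
    intro a b
    refine hi.induction_on₂ (p := fun a b => e (a * b) = e a * e b) ?_ (fun a b => ?_) a b
    · exact isClosed_eq (by fun_prop) (by fun_prop)
    · have h1 : i.toClosureRange a * i.toClosureRange b = i.toClosureRange (a * b) :=
        Subtype.ext (map_mul i a b).symm
      rw [h1, he, he, he]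
      exact Subtype.ext (map_mul j a b)
  have hstar : ∀ a, e (star a) = star (e a) := by
    intro a
    refine hi.induction_on (p := fun a => e (star a) = star (e a)) a ?_ fun a => ?_
    · exact isClosed_eq (e.continuous.comp continuous_star) e.continuous.star
    · have h1 : star (i.toClosureRange a) = i.toClosureRange (star a) :=
        Subtype.ext (map_star i a).symm
      rw [h1, he, he]
      exact Subtype.ext (map_star j a)
  exact ⟨{ toEquiv := e.toLinearEquiv.toEquiv
           map_mul' := hmul
           map_add' := map_add e
           map_star' := hstar
           map_smul' := map_smul e }, e.isometry, he⟩

end StarClosure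

open EtaleGroupoid in
theorem proposition4p10 (G : Type*) [TopologicalSpace G] [LocallyCompactSpace G] [T2Space G]
    [EtaleGroupoid G] :
    ∃ B : NonUnitalStarSubalgebra ℂ (AdjOps G),
      (B : Set (AdjOps G)) = equivariantRoe G ∧
      ∃ φ : Cc G ≃⋆ₐ[ℂ] B,
        (∀ f : Cc G, (φ f : AdjOps G) = leftReg G f) ∧
        ∃ ψ : B.topologicalClosure ≃⋆ₐ[ℂ] ReducedCStar G,
          Isometry ψ ∧
          ∀ f : Cc G, (ψ ⟨φ f, B.le_topologicalClosure (φ f).2⟩ : ProdB G) = lamHom G f := by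
  obtain ⟨ψ, hψ, hval⟩ := (leftReg G).exists_closureRange_equiv (lamHom G) norm_leftReg
  have hsurj : Function.Surjective fun f : Cc G =>
      (⟨leftReg G f, f, rfl⟩ : NonUnitalStarAlgHom.range (leftReg G)) := by
    rintro ⟨_, f, rfl⟩
    exact ⟨f, rfl⟩
  let φ : Cc G ≃⋆ₐ[ℂ] NonUnitalStarAlgHom.range (leftReg G) :=
    { toEquiv := Equiv.ofBijective _
        ⟨fun f g h => leftReg_injective (congrArg Subtype.val h), hsurj⟩
      map_mul' := fun f g => Subtype.ext (map_mul (leftReg G) f g)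
      map_add' := fun f g => Subtype.ext (map_add (leftReg G) f g)
      map_star' := fun f => Subtype.ext (map_star (leftReg G) f)
      map_smul' := fun c f => Subtype.ext (map_smul (leftReg G) c f) }
  -- Choosing the range of `Λ` as the subalgebra reduces the first claim to an equality of sets.
  -- `ReducedCStar G` is by definition the closure of the range of `lamHom G`, so `ψ` already has
  -- the required target.
  refine ⟨NonUnitalStarAlgHom.range (leftReg G), ?_, φ, fun f => rfl, ψ, hψ, fun f =>
    congrArg Subtype.val (hval f)⟩
  ext T
  exact ⟨by rintro ⟨f, rfl⟩; exact leftReg_mem_equivariantRoe f, exists_leftReg_eq⟩
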